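/- \textbf{Conventions.} For a finite non-empty sequence $S=\langle w_0,\dots,w_n\rangle$ let $e(S)=w_n$, let $S;v$ be $S$ extended by $v$, and let $Set(S)=\{\langle w_i,w_{i+1}\rangle : i<n\}$ (empty if $n=0$). For $p\in Set(S)$ let $S|_p=\langle w_0,\dots,w_u\rangle$, where $u$ is least with $\langle w_u,w_{u+1}\rangle=p$. \textbf{SLL.} Let $\mathbf P$ be a countable non-empty set of propositional atoms. The formulas of $\mathcal L$ are given by $\varphi::=p\mid\neg\varphi\mid\varphi\wedge\varphi\mid\blacklozenge\varphi\mid\langle-\rangle_1\varphi\mid\langle-\rangle_2\varphi\mid\langle+\rangle\varphi$ with $p\in\mathbf P$. A model is $M=\langle W,R_1,R_2,V\rangle$ with $W\neq\emptyset$, $R_1,R_2\subseteq W^2$ and $V:\mathbf P\to 2^W$; $M\ominus p$ and $M\oplus p$ are obtained from $M$ by replacing $R_1$ with $R_1\setminus\{p\}$ and $R_1\cup\{p\}$, respectively. A pointed model is a pair $\langle M,S\rangle$ where $S$ is a finite non-empty sequence in $W$ with $Set(S)\subseteq R_1$. Truth is defined as usual for $\neg$ and $\wedge$, and by \begin{itemize}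 \item $M,S\models p$ iff $e(S)\in V(p)$; \item $M,S\models\blacklozenge\varphi$ iff $M,S;v\models\varphi$ for some $v$ with $\langle e(S),v\rangle\in R_1$; \item $M,S\models\langle-\rangle_1\varphi$ iff $M\ominus p,\,S|_p\models\varphi$ for some $p\in Set(S)\setminus R_2$; \item $M,S\models\langle-\rangle_2\varphi$ iff $M\ominus p,\,S\models\varphi$ for some $p\in(R_1\setminus R_2)\setminus Set(S)$; \item $M,S\models\langle+\rangle\varphi$ iff $M\oplus p,\,S\models\varphi$ for some $p\in R_2\setminus R_1$. \end{itemize} \textbf{l-bisimulation.} A step leads from $\langle M,S\rangle$ to one of: $\langle M,S;v\rangle$ with $\langle e(S),v\rangle\in R_1$; $\langle M\ominus p,S|_p\rangle$ with $p\in Set(S)\setminus R_2$; $\langle M\ominus p,S\rangle$ with $p\in(R_1\setminus R_2)\setminus Set(S)$; $\langle M\oplus p,S\rangle$ with $p\in R_2\setminus R_1$. An l-bisimulation between two pointed models is a non-empty relation $Z$ between pointed models reachable from the first and pointed models reachable from the second in finitely many (possibly zero) steps, such that whenever $\langle M,S\rangle\,Z\,\langle M',S'\rangle$: \begin{itemize}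 \item (Atom) $M,S\models p$ iff $M',S'\models p$, for all $p\in\mathbf P$; \item (Zig$_\blacklozenge$) for each $v$ with $\langle e(S),v\rangle\in R_1$ there is $v'$ with $\langle e(S'),v'\rangle\in R_1'$ and $\langle M,S;v\rangle\,Z\,\langle M',S';v'\rangle$; \item (Zig$_{\langle-\rangle_1}$) for each $p\in Set(S)\setminus R_2$ there is $p'\in Set(S')\setminus R_2'$ with $\langle M\ominus p,S|_p\rangle\,Z\,\langle M'\ominus p',S'|_{p'}\rangle$; \item (Zig$_{\langle-\rangle_2}$) for each $p\in(R_1\setminus R_2)\setminus Set(S)$ there is $p'\in(R_1'\setminus R_2')\setminus Set(S')$ with $\langle M\ominus p,S\rangle\,Z\,\langle M'\ominus p',S'\rangle$; \item (Zig$_{\langle+\rangle}$) for each $p\in R_2\setminus R_1$ there is $p'\in R_2'\setminus R_1'$ with $\langle M\oplus p,S\rangle\,Z\,\langle M'\oplus p',S'\rangle$; \item (Zag) the four analogous clauses in the converse direction. \end{itemize} \textbf{First-order translation.} Let $\mathcal L_1$ be the first-order language with equality, a unary predicate $P_p$ (interpreted in $M$ as $V(p)$) for each $p\in\mathbf P$,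 and binary relation symbols $R_1,R_2$. For a finite non-empty sequence $E=\langle x_0,\dots,x_n\rangle$ of variables and finite sets $E^+,E^-$ of pairs of variables, with $y,y'$ always fresh, and writing $yy'\in F$ for $\bigvee_{\langle x,x'\rangle\in F}(y\equiv x\wedge y'\equiv x')$, the translation $\mathcal T(\varphi,E,E^+,E^-)$ commutes with $\neg$ and $\wedge$, and \begin{align*} \mathcal T(p,E,E^+,E^-)&=P_p\,e(E),\\ \mathcal T(\blacklozenge\varphi,E,E^+,E^-)&=\exists y\big((e(E)y\in E^+\vee(R_1e(E)y\wedge\neg\, e(E)y\in E^-))\wedge\mathcal T(\varphi,E;y,E^+,E^-)\big),\\ \mathcal T(\langle-\rangle_1\varphi,E,E^+,E^-)&=\exists y\exists y'\bigvee_{i}\big(y\equiv x_i\wedge y'\equiv x_{i+1}\wedge\textstyle\bigwedge_{j<i}\neg(y\equiv x_j\wedge y'\equiv x_{j+1})\wedge R_1yy'\wedge\neg R_2yy'\\ &\qquad\qquad\wedge\mathcal T(\varphi,\langle x_0,\dots,x_i\rangle,E^+,E^-\cup\{\langle y,y'\rangle\})\big),\\ \mathcal T(\langle-\rangle_2\varphi,E,E^+,E^-)&=\exists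 y\exists y'\big(R_1yy'\wedge\neg\, yy'\in Set(E)\cup E^-\cup E^+\wedge\neg R_2yy'\wedge\mathcal T(\varphi,E,E^+,E^-\cup\{\langle y,y'\rangle\})\big),\\ \mathcal T(\langle+\rangle\varphi,E,E^+,E^-)&=\exists y\exists y'\big(\neg\, yy'\in E^-\cup E^+\wedge\neg R_1yy'\wedge R_2yy'\wedge\mathcal T(\varphi,E,E^+\cup\{\langle y,y'\rangle\},E^-)\big), \end{align*} where $i$ runs over the indices $0\le i<n$ with $\langle x_i,x_{i+1}\rangle\notin E^-\cup E^+$. The translation of $\varphi$ is $\mathcal T(\varphi,\langle x\rangle,\emptyset,\emptyset)$, a formula in the one free variable $x$. \textbf{Theorem.} Let $\alpha(x)$ be an $\mathcal L_1$-formula with no free variable other than $x$. The following are equivalent: \begin{enumerate} \item there is $\varphi\in\mathcal L$ such that $\alpha(x)$ is logically equivalent to the translation of $\varphi$, i.e. $M\models\alpha[x:=w]$ iff $M\models\mathcal T(\varphi,\langle x\rangle,\emptyset,\emptyset)[x:=w]$ for every model $M$ and every world $w$ of $M$; \item $\alpha(x)$ is invariant under l-bisimulation, i.e. for all models $M,M'$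 and worlds $w,w'$ such that some l-bisimulation $Z$ between $\langle M,\langle w\rangle\rangle$ and $\langle M',\langle w'\rangle\rangle$ satisfies $\langle M,\langle w\rangle\rangle\,Z\,\langle M',\langle w'\rangle\rangle$, one has $M\models\alpha[x:=w]$ iff $M'\models\alpha[x:=w']$. \end{enumerate} -/

import Mathlib

open FirstOrder

universe u

namespace SLL

/-! ## Finite non-empty sequences -/

/-- A finite non-empty sequence `⟨w₀, …, wₙ⟩`. -/
structure NESeq (A : Type u) where
  toList : List A
  ne : toList ≠ []

namespace NESeq

variable {A B : Type u}

/-- The one-term sequence `⟨a⟩`. -/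
def single (a : A) : NESeq A := ⟨[a], by simp⟩

/-- The last element `e(S)`. -/
def last (S : NESeq A) : A := S.toList.getLast S.ne

/-- The consecutive pairs `⟨w₀,w₁⟩, …, ⟨wₙ₋₁,wₙ⟩`, in order; `Set(S)` is the set of its members. -/
def links (S : NESeq A) : List (A × A) := S.toList.zip S.toList.tail

/-- `S;a`. -/
def snoc (S : NESeq A) (a : A) : NESeq A := ⟨S.toList ++ [a], by simp⟩

/-- The initial segment `⟨w₀, …, wᵢ⟩`. -/
def initSeg (S : NESeq A) (i : ℕ) : NESeq A :=
  ⟨S.toList.take (i + 1), by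
    have := S.ne
    simp [List.take_eq_nil_iff, this]⟩

open Classical in
/-- `S|_p`: the initial segment `⟨w₀, …, wᵤ⟩` of `S`, where `⟨wᵤ,wᵤ₊₁⟩` is the first
occurrence of `p` in `S` (only used for `p ∈ Set(S)`). -/
noncomputable def cut (S : NESeq A) (p : A × A) : NESeq A :=
  S.initSeg (S.links.idxOf p)

/-- The termwise image of a sequence. -/
def map (f : A → B) (S : NESeq A) : NESeq B := ⟨S.toList.map f, by simp [S.ne]⟩

theorem links_single (a : A) : (single a).links = [] := rfl

theorem zip_tail_take (l : List A) (i : ℕ) :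
    (l.take (i + 1)).zip (l.take (i + 1)).tail = (l.zip l.tail).take i := by
  induction i generalizing l with
  | zero => cases l <;> simp
  | succ k ih =>
    match l with
    | [] => simp
    | [a] => simp
    | a :: b :: t =>
      have := ih (b :: t)
      simpa using this

theorem links_initSeg (S : NESeq A) (i : ℕ) : (S.initSeg i).links = S.links.take i :=
  zip_tail_take S.toList i

theorem zip_tail_snoc (l : List A) (h : l ≠ []) (a : A) :
    (l ++ [a]).zip (l ++ [a]).tail = l.zip l.tail ++ [(l.getLast h, a)] := by
  induction l with
  | nil => exact absurd rfl h
  | cons b t ih =>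
    cases t with
    | nil => simp
    | cons c t =>
      have := ih (by simp)
      simpa using this

theorem links_snoc (S : NESeq A) (a : A) : (S.snoc a).links = S.links ++ [(S.last, a)] :=
  zip_tail_snoc S.toList S.ne a

theorem mem_links_of_mem_cut {S : NESeq A} {p q : A × A} (h : q ∈ (S.cut p).links) :
    q ∈ S.links := by
  rw [cut, links_initSeg] at h
  exact List.mem_of_mem_take h

theorem notMem_links_cut (S : NESeq A) (p : A × A) : p ∉ (S.cut p).links := by
  classical
  rw [cut, links_initSeg]
  intro h
  obtain ⟨i, hi, hip⟩ := List.mem_iff_getElem.1 h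
  have hi' : i < S.links.idxOf p := by
    have := hi
    simp only [List.length_take] at this
    convert lt_of_lt_of_le this (min_le_left _ _)
  have := List.not_of_lt_findIdx (p := (· == p)) (xs := S.links) (i := i) hi'
  simp at this
  rw [List.getElem_take] at hip
  exact this hip

end NESeq

/-! ## Syntax and semantics of SLL -/

/-- The formulas of the language `𝓛` over the set `P` of propositional atoms. -/
inductive Formula (P : Type) : Type
  | atom (p : P) : Formula P
  | neg (φ : Formula P) : Formula P
  | and (φ ψ : Formula P) : Formula P
  /-- `⧫φ` -/
  | dia (φ : Formula P) : Formula P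
  /-- `⟨-⟩₁φ` -/
  | minusOne (φ : Formula P) : Formula P
  /-- `⟨-⟩₂φ` -/
  | minusTwo (φ : Formula P) : Formula P
  /-- `⟨+⟩φ` -/
  | plus (φ : Formula P) : Formula P

/-- A model `⟨W, R₁, R₂, V⟩` with set of worlds `W`. -/
structure Model (P : Type) (W : Type u) where
  R₁ : Set (W × W)
  R₂ : Set (W × W)
  V : P → Set W

namespace Model

variable {P : Type} {W : Type u}

/-- `M ⊖ p`. -/
def remove (M : Model P W) (p : W × W) : Model P W := ⟨M.R₁ \ {p}, M.R₂, M.V⟩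

/-- `M ⊕ p`. -/
def insert (M : Model P W) (p : W × W) : Model P W := ⟨M.R₁ ∪ {p}, M.R₂, M.V⟩

end Model

/-- A pointed model `⟨M, S⟩`: a model with an `R₁`-sequence `S`, i.e. `Set(S) ⊆ R₁`.
As sequences are non-empty, so is the set `W` of worlds. -/
structure Pointed (P : Type) (W : Type u) where
  M : Model P W
  S : NESeq W
  chain : ∀ p ∈ S.links, p ∈ M.R₁

namespace Pointed

variable {P : Type} {W : Type u}

/-- The pointed model `⟨M, w⟩` whose sequence is a singleton. -/
def single (M : Model P W) (w : W) : Pointed P W :=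
  ⟨M, NESeq.single w, by simp [NESeq.links_single]⟩

/-- `⟨M, S;v⟩` for an `R₁`-successor `v` of `e(S)`. -/
def move (X : Pointed P W) (v : W) (h : (X.S.last, v) ∈ X.M.R₁) : Pointed P W :=
  ⟨X.M, X.S.snoc v, by
    intro p hp
    rw [NESeq.links_snoc, List.mem_append, List.mem_singleton] at hp
    rcases hp with hp | rfl
    · exact X.chain p hp
    · exact h⟩

/-- `⟨M ⊖ p, S|_p⟩`. -/
noncomputable def cutLink (X : Pointed P W) (p : W × W) : Pointed P W :=
  ⟨X.M.remove p, X.S.cut p, fun q hq =>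
    ⟨X.chain q (NESeq.mem_links_of_mem_cut hq), fun h =>
      NESeq.notMem_links_cut X.S p (Set.mem_singleton_iff.1 h ▸ hq)⟩⟩

/-- `⟨M ⊖ p, S⟩` for a link `p` outside `Set(S)`. -/
def removeLink (X : Pointed P W) (p : W × W) (h : p ∉ X.S.links) : Pointed P W :=
  ⟨X.M.remove p, X.S, fun q hq =>
    ⟨X.chain q hq, fun e => h (Set.mem_singleton_iff.1 e ▸ hq)⟩⟩

/-- `⟨M ⊕ p, S⟩`. -/
def addLink (X : Pointed P W) (p : W × W) : Pointed P W :=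
  ⟨X.M.insert p, X.S, fun q hq => Or.inl (X.chain q hq)⟩

end Pointed

/-- The truth relation `M, S ⊨ φ`. -/
def Sat {P : Type} {W : Type u} : Formula P → Pointed P W → Prop
  | .atom p, X => X.S.last ∈ X.M.V p
  | .neg φ, X => ¬ Sat φ X
  | .and φ ψ, X => Sat φ X ∧ Sat ψ X
  | .dia φ, X => ∃ (v : W) (h : (X.S.last, v) ∈ X.M.R₁), Sat φ (X.move v h)
  | .minusOne φ, X => ∃ p : W × W, p ∈ X.S.links ∧ p ∉ X.M.R₂ ∧ Sat φ (X.cutLink p)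
  | .minusTwo φ, X => ∃ (p : W × W) (h : p ∉ X.S.links),
      p ∈ X.M.R₁ ∧ p ∉ X.M.R₂ ∧ Sat φ (X.removeLink p h)
  | .plus φ, X => ∃ p : W × W, p ∈ X.M.R₂ ∧ p ∉ X.M.R₁ ∧ Sat φ (X.addLink p)

/-! ## l-bisimulation -/

/-- One step between pointed models: a move along an `R₁`-link, or one of the three
changes of the model. -/
inductive Step {P : Type} {W : Type u} : Pointed P W → Pointed P W → Prop
  | move (X : Pointed P W) (v : W) (h : (X.S.last, v) ∈ X.M.R₁) : Step X (X.move v h)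
  | cutLink (X : Pointed P W) (p : W × W) (h : p ∈ X.S.links) (h₂ : p ∉ X.M.R₂) :
      Step X (X.cutLink p)
  | removeLink (X : Pointed P W) (p : W × W) (h : p ∉ X.S.links) (h₁ : p ∈ X.M.R₁)
      (h₂ : p ∉ X.M.R₂) : Step X (X.removeLink p h)
  | addLink (X : Pointed P W) (p : W × W) (h₂ : p ∈ X.M.R₂) (h₁ : p ∉ X.M.R₁) :
      Step X (X.addLink p)

/-- `Y` is reachable from `X` in finitely many steps. -/
def Reach {P : Type} {W : Type u} (X Y : Pointed P W) : Prop := Relation.ReflTransGen Step X Y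

/-- `Z` is an l-bisimulation between the pointed models `X₀` and `X₀'`. -/
structure IsLBisim {P : Type} {W W' : Type u} (X₀ : Pointed P W) (X₀' : Pointed P W')
    (Z : Pointed P W → Pointed P W' → Prop) : Prop where
  nonempty : ∃ X X', Z X X'
  reach : ∀ X X', Z X X' → Reach X₀ X ∧ Reach X₀' X'
  atom : ∀ X X', Z X X' → ∀ p : P, Sat (.atom p) X ↔ Sat (.atom p) X'
  zig_dia : ∀ X X', Z X X' → ∀ (v : W) (h : (X.S.last, v) ∈ X.M.R₁),
    ∃ (v' : W') (h' : (X'.S.last, v') ∈ X'.M.R₁), Z (X.move v h) (X'.move v' h')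
  zig_minusOne : ∀ X X', Z X X' → ∀ p : W × W, p ∈ X.S.links → p ∉ X.M.R₂ →
    ∃ p' : W' × W', p' ∈ X'.S.links ∧ p' ∉ X'.M.R₂ ∧ Z (X.cutLink p) (X'.cutLink p')
  zig_minusTwo : ∀ X X', Z X X' → ∀ (p : W × W) (h : p ∉ X.S.links),
    p ∈ X.M.R₁ → p ∉ X.M.R₂ →
    ∃ (p' : W' × W') (h' : p' ∉ X'.S.links),
      p' ∈ X'.M.R₁ ∧ p' ∉ X'.M.R₂ ∧ Z (X.removeLink p h) (X'.removeLink p' h')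
  zig_plus : ∀ X X', Z X X' → ∀ p : W × W, p ∈ X.M.R₂ → p ∉ X.M.R₁ →
    ∃ p' : W' × W', p' ∈ X'.M.R₂ ∧ p' ∉ X'.M.R₁ ∧ Z (X.addLink p) (X'.addLink p')
  zag_dia : ∀ X X', Z X X' → ∀ (v' : W') (h' : (X'.S.last, v') ∈ X'.M.R₁),
    ∃ (v : W) (h : (X.S.last, v) ∈ X.M.R₁), Z (X.move v h) (X'.move v' h')
  zag_minusOne : ∀ X X', Z X X' → ∀ p' : W' × W', p' ∈ X'.S.links → p' ∉ X'.M.R₂ →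
    ∃ p : W × W, p ∈ X.S.links ∧ p ∉ X.M.R₂ ∧ Z (X.cutLink p) (X'.cutLink p')
  zag_minusTwo : ∀ X X', Z X X' → ∀ (p' : W' × W') (h' : p' ∉ X'.S.links),
    p' ∈ X'.M.R₁ → p' ∉ X'.M.R₂ →
    ∃ (p : W × W) (h : p ∉ X.S.links),
      p ∈ X.M.R₁ ∧ p ∉ X.M.R₂ ∧ Z (X.removeLink p h) (X'.removeLink p' h')
  zag_plus : ∀ X X', Z X X' → ∀ p' : W' × W', p' ∈ X'.M.R₂ → p' ∉ X'.M.R₁ →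
    ∃ p : W × W, p ∈ X.M.R₂ ∧ p ∉ X.M.R₁ ∧ Z (X.addLink p) (X'.addLink p')

/-- `X` and `X'` are l-bisimilar. -/
def LBisimilar {P : Type} {W W' : Type u} (X : Pointed P W) (X' : Pointed P W') : Prop :=
  ∃ Z : Pointed P W → Pointed P W' → Prop, IsLBisim X X' Z ∧ Z X X'

/-! ## First-order logic -/

/-- The relation symbols of `𝓛₁`. -/
inductive Rel (P : Type) : ℕ → Type
  | pred (p : P) : Rel P 1
  | r₁ : Rel P 2
  | r₂ : Rel P 2

/-- The first-order language `𝓛₁`: a unary predicate for each atom and two binary relation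
symbols (equality is a logical symbol). -/
abbrev L₁ (P : Type) : FirstOrder.Language.{0, 0} := ⟨fun _ => Empty, Rel P⟩

/-- A model of SLL as a first-order structure. -/
abbrev Model.toStructure {P : Type} {W : Type u} (M : Model P W) : (L₁ P).Structure W where
  funMap := fun f _ => Empty.elim f
  RelMap := fun {_} r =>
    match r with
    | Rel.pred p => fun x => x 0 ∈ M.V p
    | Rel.r₁ => fun x => (x 0, x 1) ∈ M.R₁
    | Rel.r₂ => fun x => (x 0, x 1) ∈ M.R₂

/-- `M ⊨ α[x := w]`, for a first-order formula `α(x)` without free variables other than `x`. -/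
def FOSat {P : Type} {W : Type u} (M : Model P W) (α : (L₁ P).Formula Unit) (w : W) : Prop :=
  letI := M.toStructure
  α.Realize (fun _ => w)

/-! ## The first-order translation -/

/-- Variables: the variable `x`, and the variables bound by `n` nested quantifiers. -/
abbrev Var (n : ℕ) : Type := Unit ⊕ Fin n

/-- A variable, regarded under one more quantifier. -/
def up {n : ℕ} (x : Var n) : Var (n + 1) := Sum.map id Fin.castSucc x

/-- The fresh variable bound by a new quantifier. -/
def fresh (n : ℕ) : Var (n + 1) := Sum.inr (Fin.last n)

section Translation

variable {P : Type} {n : ℕ}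

/-- The atomic formula `Pₚ x`. -/
def predF (p : P) (x : Var n) : (L₁ P).BoundedFormula Unit n :=
  FirstOrder.Language.Relations.boundedFormula₁ (L := L₁ P) (Rel.pred p) (FirstOrder.Language.Term.var x)

/-- The atomic formula `R₁ x y`. -/
def r₁F (x y : Var n) : (L₁ P).BoundedFormula Unit n :=
  FirstOrder.Language.Relations.boundedFormula₂ (L := L₁ P) Rel.r₁ (FirstOrder.Language.Term.var x) (FirstOrder.Language.Term.var y)

/-- The atomic formula `R₂ x y`. -/
def r₂F (x y : Var n) : (L₁ P).BoundedFormula Unit n :=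
  FirstOrder.Language.Relations.boundedFormula₂ (L := L₁ P) Rel.r₂ (FirstOrder.Language.Term.var x) (FirstOrder.Language.Term.var y)

/-- The formula `y ≡ x ∧ y' ≡ x'`, where `q = ⟨y, y'⟩` and `p = ⟨x, x'⟩`. -/
def linkEq (q p : Var n × Var n) : (L₁ P).BoundedFormula Unit n :=
  FirstOrder.Language.Term.bdEqual (FirstOrder.Language.Term.var q.1) (FirstOrder.Language.Term.var p.1) ⊓
    FirstOrder.Language.Term.bdEqual (FirstOrder.Language.Term.var q.2) (FirstOrder.Language.Term.var p.2)

/-- Finite disjunction. -/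
def disj (l : List ((L₁ P).BoundedFormula Unit n)) : (L₁ P).BoundedFormula Unit n :=
  l.foldr (· ⊔ ·) ⊥

/-- The formula `⋁_{⟨x,x'⟩ ∈ F} (y ≡ x ∧ y' ≡ x')`, where `q = ⟨y, y'⟩`. -/
def oneOf (q : Var n × Var n) (F : List (Var n × Var n)) : (L₁ P).BoundedFormula Unit n :=
  disj (F.map (linkEq q))

/-- Links under one more quantifier. -/
def upLinks (F : List (Var n × Var n)) : List (Var (n + 1) × Var (n + 1)) :=
  F.map (Prod.map up up)

/-- The links of `E` outside `F`, each with its position in `E`. -/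
def positions (E : NESeq (Var n)) (F : List (Var n × Var n)) :
    List ((Var n × Var n) × ℕ) :=
  E.links.zipIdx.filter (fun q => decide (∀ p ∈ F, q.1 ≠ p))

end Translation

/-- The translation `𝒯(φ, E, E⁺, E⁻)`, with finite sets of links given as lists.
In the clause for `⟨-⟩₁`, the sequence `E|_⟨y,y'⟩` depends on the values of the variables: it is
`⟨x₀, …, xᵢ⟩` for the least `i` such that `y ≡ xᵢ` and `y' ≡ xᵢ₊₁`. The disjunction over the links
of `E` therefore runs over their positions `i`, and its `i`-th member says that `i` is least and
contains the translation for `⟨x₀, …, xᵢ⟩`. -/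
def translate {P : Type} : Formula P → (n : ℕ) → NESeq (Var n) →
    List (Var n × Var n) → List (Var n × Var n) → (L₁ P).BoundedFormula Unit n
  | .atom p, _, E, _, _ => predF p E.last
  | .neg φ, n, E, Ep, Em => ∼(translate φ n E Ep Em)
  | .and φ ψ, n, E, Ep, Em => translate φ n E Ep Em ⊓ translate ψ n E Ep Em
  | .dia φ, n, E, Ep, Em =>
      let y := fresh n
      let E' := E.map up
      let Ep' := upLinks Ep
      let Em' := upLinks Em
      ∃' ((oneOf (E'.last, y) Ep' ⊔ (r₁F E'.last y ⊓ ∼(oneOf (E'.last, y) Em'))) ⊓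
        translate φ (n + 1) (E'.snoc y) Ep' Em')
  | .minusOne φ, n, E, Ep, Em =>
      let y := up (fresh n)
      let y' := fresh (n + 1)
      let E' := (E.map up).map up
      let Ep' := upLinks (upLinks Ep)
      let Em' := upLinks (upLinks Em)
      ∃' ∃' (disj ((positions E' (Em' ++ Ep')).map (fun q =>
          linkEq (y, y') q.1 ⊓ ∼(oneOf (y, y') (E'.links.take q.2)) ⊓
            (r₁F y y' ⊓ ∼(r₂F y y') ⊓
              translate φ (n + 2) (E'.initSeg q.2) Ep' ((y, y') :: Em')))))
  | .minusTwo φ, n, E, Ep, Em =>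
      let y := up (fresh n)
      let y' := fresh (n + 1)
      let E' := (E.map up).map up
      let Ep' := upLinks (upLinks Ep)
      let Em' := upLinks (upLinks Em)
      ∃' ∃' (r₁F y y' ⊓ ∼(oneOf (y, y') (E'.links ++ Em' ++ Ep')) ⊓ ∼(r₂F y y') ⊓
        translate φ (n + 2) E' Ep' ((y, y') :: Em'))
  | .plus φ, n, E, Ep, Em =>
      let y := up (fresh n)
      let y' := fresh (n + 1)
      let E' := (E.map up).map up
      let Ep' := upLinks (upLinks Ep)
      let Em' := upLinks (upLinks Em)
      ∃' ∃' (∼(oneOf (y, y') (Em' ++ Ep')) ⊓ ∼(r₁F y y') ⊓ r₂F y y' ⊓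
        translate φ (n + 2) E' ((y, y') :: Ep') Em')

/-- The translation `𝒯(φ, ⟨x⟩, ∅, ∅)`, a first-order formula in the one free variable `x`. -/
def translation {P : Type} (φ : Formula P) : (L₁ P).Formula Unit :=
  translate φ 0 (NESeq.single (Sum.inl ())) [] []

/-- `α(x)` and `β(x)` are logically equivalent. -/
def FOEquiv {P : Type} (α β : (L₁ P).Formula Unit) : Prop :=
  ∀ (W : Type u) (M : Model P W) (w : W), FOSat M α w ↔ FOSat M β w

/-- `α(x)` is invariant under l-bisimulation. -/
def LBisimInvariant {P : Type} (α : (L₁ P).Formula Unit) : Prop :=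
  ∀ (W W' : Type u) (M : Model P W) (M' : Model P W') (w : W) (w' : W'),
    LBisimilar (Pointed.single M w) (Pointed.single M' w') → (FOSat M α w ↔ FOSat M' α w')

end SLL

-- This is a van Benthem style argument by ultraproducts. From translations to invariance: the
-- translation never changes the model, but records the deletions and additions in its argument
-- lists. By `bsat_translate_iff` it expresses truth in the changed model, and truth of SLL formulas
-- is invariant under l-bisimulation (`IsLBisim.sat_iff`).
--
-- Conversely, suppose that `α` is invariant but equivalent to no translation. Then no finite set of
-- SLL formulas decides `α`, since otherwise a Boolean combination of them would define it
-- (`exists_agree_of_not_equiv`). Enumerate the formulas and choose, for each `n`, two pointed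
-- models that agree on the first `n` formulas, with `α` true in the first and false in the second.
-- Take the ultraproducts of both families over a nonprincipal ultrafilter on `ℕ`. Łoś's theorem for
-- SLL (`sat_lim_iff`) makes them satisfy the same formulas, while the first-order Łoś theorem keeps
-- `α` true in one and false in the other. It remains to see that they are l-bisimilar.
--
-- For this, modal equivalence itself serves as the relation. A step from one side has to be
-- answered by a step to a pointed model with the same theory; finite parts of that theory can be
-- answered, and countable saturation (`exists_forall_eventually`) yields an answer to the whole of
-- it. Saturation has to be available again after each step, in a changed model with a changed
-- sequence. It is, because every step from an ultraproduct of pointed models leads to such an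
-- ultraproduct (`IsLim.exists_of_linkStep`).

universe v

namespace SLL

/-! ### Sequences and links under termwise maps -/

namespace NESeq

variable {A : Type u} {B : Type v}

theorem ext_toList {S T : NESeq A} (h : S.toList = T.toList) : S = T := by
  cases S; cases T; simpa using h

/-- The termwise image of a sequence under a map between types in different universes. -/
def image (f : A → B) (S : NESeq A) : NESeq B := ⟨S.toList.map f, by simp [S.ne]⟩

theorem last_image (f : A → B) (S : NESeq A) : (S.image f).last = f S.last := by
  simp [last, image, List.getLast_map]

theorem links_image (f : A → B) (S : NESeq A) :
    (S.image f).links = S.links.map (Prod.map f f) := by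
  simp [links, image, ← List.map_tail, List.zip_map]

theorem snoc_image (f : A → B) (S : NESeq A) (a : A) :
    (S.snoc a).image f = (S.image f).snoc (f a) :=
  ext_toList (by simp [snoc, image])

theorem initSeg_image (f : A → B) (S : NESeq A) (i : ℕ) :
    (S.initSeg i).image f = (S.image f).initSeg i :=
  ext_toList (by simp [initSeg, image, List.map_take])

theorem map_image {A' : Type u} (f : A → A') (g : A' → B) (S : NESeq A) :
    (S.map f).image g = S.image (g ∘ f) :=
  ext_toList (by simp [map, image])

open Classical in
/-- The first occurrence of a link determines the initial segment cut off by it. -/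
theorem cut_eq_initSeg {S : NESeq A} {p : A × A} {i : ℕ} (hi : S.links[i]? = some p)
    (hlt : p ∉ S.links.take i) : S.cut p = S.initSeg i := by
  obtain ⟨h, hp⟩ := List.getElem?_eq_some_iff.1 hi
  have hle : S.links.idxOf p ≤ i := by
    by_contra hc
    have := List.not_of_lt_findIdx (p := (· == p)) (not_le.1 hc)
    simp [hp] at this
  have : S.links.idxOf p = i := by
    refine le_antisymm hle (not_lt.1 fun hlt' => hlt ?_)
    have hl : S.links.idxOf p < S.links.length := hlt'.trans h
    rw [List.mem_iff_getElem]
    exact ⟨S.links.idxOf p, by simp [hlt', hl], by simp⟩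
  rw [cut, this]

end NESeq

variable {P : Type} {W W' : Type u}

theorem Pointed.ext_of {X Y : Pointed P W} (hM : X.M = Y.M) (hS : X.S = Y.S) : X = Y := by
  cases X; cases Y; cases hM; cases hS; rfl

/-! ## Labelled steps -/

/-- The four modalities. -/
inductive Modality
  | dia | minusOne | minusTwo | plus

/-- The formula obtained by applying a modality. -/
def Modality.app : Modality → Formula P → Formula P
  | .dia => .dia
  | .minusOne => .minusOne
  | .minusTwo => .minusTwo
  | .plus => .plus

/-- The step of a given kind along the link `p` is possible. -/
def Enabled : Modality → Pointed P W → W × W → Prop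
  | .dia, X, p => p ∈ X.M.R₁ ∧ p.1 = X.S.last
  | .minusOne, X, p => p ∈ X.S.links ∧ p ∉ X.M.R₂
  | .minusTwo, X, p => p ∉ X.S.links ∧ p ∈ X.M.R₁ ∧ p ∉ X.M.R₂
  | .plus, X, p => p ∈ X.M.R₂ ∧ p ∉ X.M.R₁

/-- The model after a step. -/
def nextModel : Modality → Model P W → W × W → Model P W
  | .dia, M, _ => M
  | .minusOne, M, p => M.remove p
  | .minusTwo, M, p => M.remove p
  | .plus, M, p => M.insert p

/-- The sequence after a step. -/
noncomputable def nextSeq : Modality → NESeq W → W × W → NESeq W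
  | .dia, S, p => S.snoc p.2
  | .minusOne, S, p => S.cut p
  | .minusTwo, S, _ => S
  | .plus, S, _ => S

/-- `Y` results from `X` by the step of a given kind along the link `p`. -/
structure LinkStep (k : Modality) (X : Pointed P W) (p : W × W) (Y : Pointed P W) : Prop where
  enabled : Enabled k X p
  model : Y.M = nextModel k X.M p
  seq : Y.S = nextSeq k X.S p

/-- This and the next three lemmas replace the dependent proof arguments of the operations on
pointed models by one relation labelled with a modality and a link, so that later arguments need not
distinguish the four modalities. -/
theorem linkStep_dia_iff {X Y : Pointed P W} {p : W × W} :
    LinkStep .dia X p Y ↔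
      ∃ (v : W) (h : (X.S.last, v) ∈ X.M.R₁), p = (X.S.last, v) ∧ Y = X.move v h := by
  constructor
  · rintro ⟨⟨h, h₁⟩, h₂, h₃⟩
    obtain ⟨a, b⟩ := p
    obtain rfl : a = X.S.last := h₁
    exact ⟨b, h, rfl, Pointed.ext_of h₂ h₃⟩
  · rintro ⟨v, h, rfl, rfl⟩
    exact ⟨⟨h, rfl⟩, rfl, rfl⟩

theorem linkStep_minusOne_iff {X Y : Pointed P W} {p : W × W} :
    LinkStep .minusOne X p Y ↔ p ∈ X.S.links ∧ p ∉ X.M.R₂ ∧ Y = X.cutLink p := by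
  constructor
  · rintro ⟨⟨h, h₁⟩, h₂, h₃⟩
    exact ⟨h, h₁, Pointed.ext_of h₂ h₃⟩
  · rintro ⟨h, h₁, rfl⟩
    exact ⟨⟨h, h₁⟩, rfl, rfl⟩

theorem linkStep_minusTwo_iff {X Y : Pointed P W} {p : W × W} :
    LinkStep .minusTwo X p Y ↔
      ∃ h : p ∉ X.S.links, p ∈ X.M.R₁ ∧ p ∉ X.M.R₂ ∧ Y = X.removeLink p h := by
  constructor
  · rintro ⟨⟨h, h₁, h₂⟩, h₃, h₄⟩
    exact ⟨h, h₁, h₂, Pointed.ext_of h₃ h₄⟩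
  · rintro ⟨h, h₁, h₂, rfl⟩
    exact ⟨⟨h, h₁, h₂⟩, rfl, rfl⟩

theorem linkStep_plus_iff {X Y : Pointed P W} {p : W × W} :
    LinkStep .plus X p Y ↔ p ∈ X.M.R₂ ∧ p ∉ X.M.R₁ ∧ Y = X.addLink p := by
  constructor
  · rintro ⟨⟨h, h₁⟩, h₂, h₃⟩
    exact ⟨h, h₁, Pointed.ext_of h₂ h₃⟩
  · rintro ⟨h, h₁, rfl⟩
    exact ⟨⟨h, h₁⟩, rfl, rfl⟩

theorem LinkStep.step {k : Modality} {X Y : Pointed P W} {p : W × W} (h : LinkStep k X p Y) :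
    Step X Y := by
  cases k with
  | dia =>
    obtain ⟨v, hv, rfl, rfl⟩ := linkStep_dia_iff.1 h
    exact .move X v hv
  | minusOne =>
    obtain ⟨h₁, h₂, rfl⟩ := linkStep_minusOne_iff.1 h
    exact .cutLink X p h₁ h₂
  | minusTwo =>
    obtain ⟨h₀, h₁, h₂, rfl⟩ := linkStep_minusTwo_iff.1 h
    exact .removeLink X p h₀ h₁ h₂
  | plus =>
    obtain ⟨h₁, h₂, rfl⟩ := linkStep_plus_iff.1 h
    exact .addLink X p h₁ h₂

theorem Enabled.exists_linkStep {k : Modality} {X : Pointed P W} {p : W × W}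
    (h : Enabled k X p) : ∃ Y, LinkStep k X p Y := by
  cases k with
  | dia =>
    obtain ⟨a, b⟩ := p
    obtain ⟨h₁, h₂⟩ := h
    obtain rfl : a = X.S.last := h₂
    exact ⟨X.move b h₁, linkStep_dia_iff.2 ⟨b, h₁, rfl, rfl⟩⟩
  | minusOne => exact ⟨_, linkStep_minusOne_iff.2 ⟨h.1, h.2, rfl⟩⟩
  | minusTwo => exact ⟨_, linkStep_minusTwo_iff.2 ⟨h.1, h.2.1, h.2.2, rfl⟩⟩
  | plus => exact ⟨_, linkStep_plus_iff.2 ⟨h.1, h.2, rfl⟩⟩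

/-- Every modality is an ordinary diamond over the labelled step relation; this is the only fact
about the modal clauses that the ultraproduct argument needs. -/
theorem sat_app_iff {k : Modality} {φ : Formula P} {X : Pointed P W} :
    Sat (k.app φ) X ↔ ∃ p Y, LinkStep k X p Y ∧ Sat φ Y := by
  cases k with
  | dia =>
    constructor
    · rintro ⟨v, h, hs⟩
      exact ⟨_, _, linkStep_dia_iff.2 ⟨v, h, rfl, rfl⟩, hs⟩
    · rintro ⟨p, Y, h, hs⟩
      obtain ⟨v, hv, rfl, rfl⟩ := linkStep_dia_iff.1 h
      exact ⟨v, hv, hs⟩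
  | minusOne =>
    constructor
    · rintro ⟨p, h₁, h₂, hs⟩
      exact ⟨_, _, linkStep_minusOne_iff.2 ⟨h₁, h₂, rfl⟩, hs⟩
    · rintro ⟨p, Y, h, hs⟩
      obtain ⟨h₁, h₂, rfl⟩ := linkStep_minusOne_iff.1 h
      exact ⟨p, h₁, h₂, hs⟩
  | minusTwo =>
    constructor
    · rintro ⟨p, h, h₁, h₂, hs⟩
      exact ⟨_, _, linkStep_minusTwo_iff.2 ⟨h, h₁, h₂, rfl⟩, hs⟩
    · rintro ⟨p, Y, h, hs⟩
      obtain ⟨h₀, h₁, h₂, rfl⟩ := linkStep_minusTwo_iff.1 h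
      exact ⟨p, h₀, h₁, h₂, hs⟩
  | plus =>
    constructor
    · rintro ⟨p, h₁, h₂, hs⟩
      exact ⟨_, _, linkStep_plus_iff.2 ⟨h₁, h₂, rfl⟩, hs⟩
    · rintro ⟨p, Y, h, hs⟩
      obtain ⟨h₁, h₂, rfl⟩ := linkStep_plus_iff.1 h
      exact ⟨p, h₁, h₂, hs⟩

/-- Induction on formulas, treating the modalities uniformly. -/
theorem Formula.modal_induction {C : Formula P → Prop} (atom : ∀ p, C (.atom p))
    (neg : ∀ φ, C φ → C (.neg φ)) (and : ∀ φ ψ, C φ → C ψ → C (.and φ ψ))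
    (app : ∀ (k : Modality) φ, C φ → C (k.app φ)) (φ : Formula P) : C φ := by
  induction φ with
  | atom p => exact atom p
  | neg φ ih => exact neg φ ih
  | and φ ψ ih₁ ih₂ => exact and φ ψ ih₁ ih₂
  | dia φ ih => exact app .dia φ ih
  | minusOne φ ih => exact app .minusOne φ ih
  | minusTwo φ ih => exact app .minusTwo φ ih
  | plus φ ih => exact app .plus φ ih

/-! ## Invariance of truth under l-bisimulation -/

theorem IsLBisim.sat_iff {X₀ : Pointed P W} {X₀' : Pointed P W'}
    {Z : Pointed P W → Pointed P W' → Prop} (hZ : IsLBisim X₀ X₀' Z) (φ : Formula P) :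
    ∀ X X', Z X X' → (Sat φ X ↔ Sat φ X') := by
  induction φ with
  | atom p => exact fun X X' h => hZ.atom X X' h p
  | neg φ ih => exact fun X X' h => not_congr (ih X X' h)
  | and φ ψ ih₁ ih₂ => exact fun X X' h => and_congr (ih₁ X X' h) (ih₂ X X' h)
  | dia φ ih =>
    refine fun X X' h => ⟨?_, ?_⟩
    · rintro ⟨v, hv, hs⟩
      obtain ⟨v', hv', hz⟩ := hZ.zig_dia X X' h v hv
      exact ⟨v', hv', (ih _ _ hz).1 hs⟩
    · rintro ⟨v', hv', hs⟩
      obtain ⟨v, hv, hz⟩ := hZ.zag_dia X X' h v' hv'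
      exact ⟨v, hv, (ih _ _ hz).2 hs⟩
  | minusOne φ ih =>
    refine fun X X' h => ⟨?_, ?_⟩
    · rintro ⟨p, h₁, h₂, hs⟩
      obtain ⟨p', h₁', h₂', hz⟩ := hZ.zig_minusOne X X' h p h₁ h₂
      exact ⟨p', h₁', h₂', (ih _ _ hz).1 hs⟩
    · rintro ⟨p', h₁', h₂', hs⟩
      obtain ⟨p, h₁, h₂, hz⟩ := hZ.zag_minusOne X X' h p' h₁' h₂'
      exact ⟨p, h₁, h₂, (ih _ _ hz).2 hs⟩
  | minusTwo φ ih =>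
    refine fun X X' h => ⟨?_, ?_⟩
    · rintro ⟨p, h₀, h₁, h₂, hs⟩
      obtain ⟨p', h₀', h₁', h₂', hz⟩ := hZ.zig_minusTwo X X' h p h₀ h₁ h₂
      exact ⟨p', h₀', h₁', h₂', (ih _ _ hz).1 hs⟩
    · rintro ⟨p', h₀', h₁', h₂', hs⟩
      obtain ⟨p, h₀, h₁, h₂, hz⟩ := hZ.zag_minusTwo X X' h p' h₀' h₁' h₂'
      exact ⟨p, h₀, h₁, h₂, (ih _ _ hz).2 hs⟩
  | plus φ ih =>
    refine fun X X' h => ⟨?_, ?_⟩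
    · rintro ⟨p, h₁, h₂, hs⟩
      obtain ⟨p', h₁', h₂', hz⟩ := hZ.zig_plus X X' h p h₁ h₂
      exact ⟨p', h₁', h₂', (ih _ _ hz).1 hs⟩
    · rintro ⟨p', h₁', h₂', hs⟩
      obtain ⟨p, h₁, h₂, hz⟩ := hZ.zag_plus X X' h p' h₁' h₂'
      exact ⟨p, h₁, h₂, (ih _ _ hz).2 hs⟩

/-- A relation satisfying the back and forth conditions for labelled steps, restricted to the
reachable pointed models, is an l-bisimulation. -/
theorem lBisimilar_of_linkStep {X₀ : Pointed P W} {X₀' : Pointed P W'}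
    {Z : Pointed P W → Pointed P W' → Prop} (h₀ : Z X₀ X₀')
    (atom : ∀ X X', Z X X' → ∀ p : P, Sat (.atom p) X ↔ Sat (.atom p) X')
    (zig : ∀ k X X', Z X X' → ∀ p Y, LinkStep k X p Y → ∃ p' Y', LinkStep k X' p' Y' ∧ Z Y Y')
    (zag : ∀ k X X', Z X X' → ∀ p' Y', LinkStep k X' p' Y' → ∃ p Y, LinkStep k X p Y ∧ Z Y Y') :
    LBisimilar X₀ X₀' := by
  -- The definition of l-bisimulation demands reachability; cutting down to reachable pairs is
  -- harmless because every answering step extends a reachability path.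
  let Z' : Pointed P W → Pointed P W' → Prop := fun X X' =>
    (Reach X₀ X ∧ Reach X₀' X') ∧ Z X X'
  have zig' : ∀ k X X', Z' X X' → ∀ p Y, LinkStep k X p Y →
      ∃ p' Y', LinkStep k X' p' Y' ∧ Z' Y Y' := by
    rintro k X X' ⟨⟨r, r'⟩, h⟩ p Y hY
    obtain ⟨p', Y', hY', hz⟩ := zig k X X' h p Y hY
    exact ⟨p', Y', hY', ⟨r.tail hY.step, r'.tail hY'.step⟩, hz⟩
  have zag' : ∀ k X X', Z' X X' → ∀ p' Y', LinkStep k X' p' Y' →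
      ∃ p Y, LinkStep k X p Y ∧ Z' Y Y' := by
    rintro k X X' ⟨⟨r, r'⟩, h⟩ p' Y' hY'
    obtain ⟨p, Y, hY, hz⟩ := zag k X X' h p' Y' hY'
    exact ⟨p, Y, hY, ⟨r.tail hY.step, r'.tail hY'.step⟩, hz⟩
  have hz₀ : Z' X₀ X₀' := ⟨⟨.refl, .refl⟩, h₀⟩
  refine ⟨Z', ⟨⟨_, _, hz₀⟩, fun _ _ h => h.1, fun X X' h => atom X X' h.2,
    ?_, ?_, ?_, ?_, ?_, ?_, ?_, ?_⟩, hz₀⟩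
  · intro X X' h v hv
    obtain ⟨p', Y', hY', hz⟩ := zig' .dia X X' h _ _ (linkStep_dia_iff.2 ⟨v, hv, rfl, rfl⟩)
    obtain ⟨v', hv', -, rfl⟩ := linkStep_dia_iff.1 hY'
    exact ⟨v', hv', hz⟩
  · intro X X' h p h₁ h₂
    obtain ⟨p', Y', hY', hz⟩ :=
      zig' .minusOne X X' h _ _ (linkStep_minusOne_iff.2 ⟨h₁, h₂, rfl⟩)
    obtain ⟨h₁', h₂', rfl⟩ := linkStep_minusOne_iff.1 hY'
    exact ⟨p', h₁', h₂', hz⟩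
  · intro X X' h p h₀ h₁ h₂
    obtain ⟨p', Y', hY', hz⟩ :=
      zig' .minusTwo X X' h _ _ (linkStep_minusTwo_iff.2 ⟨h₀, h₁, h₂, rfl⟩)
    obtain ⟨h₀', h₁', h₂', rfl⟩ := linkStep_minusTwo_iff.1 hY'
    exact ⟨p', h₀', h₁', h₂', hz⟩
  · intro X X' h p h₁ h₂
    obtain ⟨p', Y', hY', hz⟩ := zig' .plus X X' h _ _ (linkStep_plus_iff.2 ⟨h₁, h₂, rfl⟩)
    obtain ⟨h₁', h₂', rfl⟩ := linkStep_plus_iff.1 hY'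
    exact ⟨p', h₁', h₂', hz⟩
  · intro X X' h v hv
    obtain ⟨p', Y', hY', hz⟩ := zag' .dia X X' h _ _ (linkStep_dia_iff.2 ⟨v, hv, rfl, rfl⟩)
    obtain ⟨v', hv', -, rfl⟩ := linkStep_dia_iff.1 hY'
    exact ⟨v', hv', hz⟩
  · intro X X' h p h₁ h₂
    obtain ⟨p', Y', hY', hz⟩ :=
      zag' .minusOne X X' h _ _ (linkStep_minusOne_iff.2 ⟨h₁, h₂, rfl⟩)
    obtain ⟨h₁', h₂', rfl⟩ := linkStep_minusOne_iff.1 hY'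
    exact ⟨p', h₁', h₂', hz⟩
  · intro X X' h p h₀ h₁ h₂
    obtain ⟨p', Y', hY', hz⟩ :=
      zag' .minusTwo X X' h _ _ (linkStep_minusTwo_iff.2 ⟨h₀, h₁, h₂, rfl⟩)
    obtain ⟨h₀', h₁', h₂', rfl⟩ := linkStep_minusTwo_iff.1 hY'
    exact ⟨p', h₀', h₁', h₂', hz⟩
  · intro X X' h p h₁ h₂
    obtain ⟨p', Y', hY', hz⟩ := zag' .plus X X' h _ _ (linkStep_plus_iff.2 ⟨h₁, h₂, rfl⟩)
    obtain ⟨h₁', h₂', rfl⟩ := linkStep_plus_iff.1 hY'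
    exact ⟨p', h₁', h₂', hz⟩

end SLL

namespace SLL

variable {P : Type} {W : Type u}

/-! ## Correctness of the first-order translation -/

/-- `M ⊨ φ` under an assignment of values to the variables. -/
def BSat {n : ℕ} (M : Model P W) (φ : (L₁ P).BoundedFormula Unit n) (σ : Var n → W) : Prop :=
  letI := M.toStructure
  φ.Realize (σ ∘ Sum.inl) (σ ∘ Sum.inr)

/-- The assignment `σ` extended by the value `a` of a fresh variable. -/
def extend {n : ℕ} (σ : Var n → W) (a : W) : Var (n + 1) → W :=
  Sum.elim (σ ∘ Sum.inl) (Fin.snoc (α := fun _ => W) (σ ∘ Sum.inr) a)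

section

variable {n : ℕ} {M : Model P W} {φ ψ : (L₁ P).BoundedFormula Unit n} {σ : Var n → W}

theorem extend_comp_up (a : W) : extend σ a ∘ up = σ := by
  funext x
  rcases x with x | x <;> simp [extend, up]

theorem extend_up (a : W) (x : Var n) : extend σ a (up x) = σ x :=
  congrFun (extend_comp_up a) x

theorem extend_fresh (a : W) : extend σ a (fresh n) = a := by
  simp [extend, fresh]

theorem bsat_not : BSat M (∼φ) σ ↔ ¬ BSat M φ σ :=
  let := M.toStructure
  Language.BoundedFormula.realize_not

theorem bsat_inf : BSat M (φ ⊓ ψ) σ ↔ BSat M φ σ ∧ BSat M ψ σ :=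
  let := M.toStructure
  Language.BoundedFormula.realize_inf

theorem bsat_sup : BSat M (φ ⊔ ψ) σ ↔ BSat M φ σ ∨ BSat M ψ σ :=
  let := M.toStructure
  Language.BoundedFormula.realize_sup

theorem bsat_ex {φ : (L₁ P).BoundedFormula Unit (n + 1)} :
    BSat M (∃' φ) σ ↔ ∃ a, BSat M φ (extend σ a) :=
  let := M.toStructure
  Language.BoundedFormula.realize_ex

theorem elim_comp_inl_inr : Sum.elim (σ ∘ Sum.inl) (σ ∘ Sum.inr) = σ :=
  Sum.elim_comp_inl_inr σ

theorem bsat_predF {p : P} {x : Var n} : BSat M (predF p x) σ ↔ σ x ∈ M.V p := by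
  let := M.toStructure
  unfold BSat predF
  rw [Language.BoundedFormula.realize_rel₁, elim_comp_inl_inr]
  exact Iff.rfl

theorem bsat_r₁F {x y : Var n} : BSat M (r₁F x y) σ ↔ (σ x, σ y) ∈ M.R₁ := by
  let := M.toStructure
  unfold BSat r₁F
  rw [Language.BoundedFormula.realize_rel₂, elim_comp_inl_inr]
  exact Iff.rfl

theorem bsat_r₂F {x y : Var n} : BSat M (r₂F x y) σ ↔ (σ x, σ y) ∈ M.R₂ := by
  let := M.toStructure
  unfold BSat r₂F
  rw [Language.BoundedFormula.realize_rel₂, elim_comp_inl_inr]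
  exact Iff.rfl

theorem bsat_linkEq {q p : Var n × Var n} :
    BSat M (linkEq q p) σ ↔ Prod.map σ σ q = Prod.map σ σ p := by
  let := M.toStructure
  unfold BSat linkEq
  rw [Language.BoundedFormula.realize_inf, Language.BoundedFormula.realize_bdEqual,
    Language.BoundedFormula.realize_bdEqual, elim_comp_inl_inr]
  simp [Prod.ext_iff]

theorem bsat_disj {l : List ((L₁ P).BoundedFormula Unit n)} :
    BSat M (disj l) σ ↔ ∃ φ ∈ l, BSat M φ σ :=
  let := M.toStructure
  Language.BoundedFormula.realize_foldr_sup l _ _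

theorem bsat_oneOf {q : Var n × Var n} {F : List (Var n × Var n)} :
    BSat M (oneOf q F) σ ↔ Prod.map σ σ q ∈ F.map (Prod.map σ σ) := by
  simp only [oneOf, bsat_disj, List.mem_map, exists_exists_and_eq_and, bsat_linkEq]
  exact exists_congr fun _ => and_congr_right fun _ => eq_comm

theorem map_upLinks (F : List (Var n × Var n)) (a : W) :
    (upLinks F).map (Prod.map (extend σ a) (extend σ a)) = F.map (Prod.map σ σ) := by
  simp [upLinks, Prod.map_comp_map, extend_comp_up]

theorem image_map_up (E : NESeq (Var n)) (a : W) :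
    (E.map up).image (extend σ a) = E.image σ := by
  rw [NESeq.map_image, extend_comp_up]

end

/-- The pointed model `X` is obtained from `M` by adding the values of the links in `Ep`, removing
those of the links in `Em`, and taking the values of `E` as its sequence. -/
structure Represents {n : ℕ} (M : Model P W) (σ : Var n → W) (E : NESeq (Var n))
    (Ep Em : List (Var n × Var n)) (X : Pointed P W) : Prop where
  seq : X.S = E.image σ
  val : X.M.V = M.V
  rel₂ : X.M.R₂ = M.R₂
  rel₁ : ∀ q, q ∈ X.M.R₁ ↔
    (q ∈ M.R₁ ∨ q ∈ Ep.map (Prod.map σ σ)) ∧ q ∉ Em.map (Prod.map σ σ)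
  added : ∀ q ∈ Ep.map (Prod.map σ σ), q ∈ M.R₂ ∧ q ∉ M.R₁
  removed : ∀ q ∈ Em.map (Prod.map σ σ), q ∈ M.R₁ ∧ q ∉ M.R₂

section

variable {n : ℕ} {M : Model P W} {σ : Var n → W} {E : NESeq (Var n)}
  {Ep Em : List (Var n × Var n)} {X Y : Pointed P W}

theorem Represents.last_eq (h : Represents M σ E Ep Em X) : X.S.last = σ E.last := by
  rw [h.seq, NESeq.last_image]

theorem Represents.links_eq (h : Represents M σ E Ep Em X) :
    X.S.links = E.links.map (Prod.map σ σ) := by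
  rw [h.seq, NESeq.links_image]

theorem Represents.up (h : Represents M σ E Ep Em X) (a : W) :
    Represents M (extend σ a) (E.map up) (upLinks Ep) (upLinks Em) X where
  seq := by rw [h.seq, image_map_up]
  val := h.val
  rel₂ := h.rel₂
  rel₁ := by simpa only [map_upLinks] using h.rel₁
  added := by simpa only [map_upLinks] using h.added
  removed := by simpa only [map_upLinks] using h.removed

theorem Represents.move (h : Represents M σ E Ep Em X) (y : Var n)
    (hy : (X.S.last, σ y) ∈ X.M.R₁) :
    Represents M σ (E.snoc y) Ep Em (X.move (σ y) hy) where
  seq := by rw [NESeq.snoc_image, ← h.seq]; rfl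
  val := h.val
  rel₂ := h.rel₂
  rel₁ := h.rel₁
  added := h.added
  removed := h.removed

/-- The new sequence `E'` is left free so that the lemma serves both deletions: the one that cuts
the sequence and the one that keeps it. -/
theorem Represents.remove (h : Represents M σ E Ep Em X) {q : Var n × Var n}
    {E' : NESeq (Var n)} (hS : Y.S = E'.image σ) (hM : Y.M = X.M.remove (Prod.map σ σ q))
    (h₁ : Prod.map σ σ q ∈ M.R₁) (h₂ : Prod.map σ σ q ∉ M.R₂) :
    Represents M σ E' Ep (q :: Em) Y where
  seq := hS
  val := by rw [hM]; exact h.val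
  rel₂ := by rw [hM]; exact h.rel₂
  rel₁ := by
    intro p
    have := h.rel₁ p
    rw [hM, List.map_cons, List.mem_cons, not_or]
    change p ∈ X.M.R₁ ∧ p ∉ ({_} : Set _) ↔ _
    rw [Set.mem_singleton_iff]
    tauto
  added := h.added
  removed := by
    intro p hp
    rcases List.mem_cons.1 (by simpa only [List.map_cons] using hp) with rfl | hp
    · exact ⟨h₁, h₂⟩
    · exact h.removed p hp

theorem Represents.insert (h : Represents M σ E Ep Em X) {q : Var n × Var n}
    (h₁ : Prod.map σ σ q ∉ M.R₁) (h₂ : Prod.map σ σ q ∈ M.R₂) :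
    Represents M σ E (q :: Ep) Em (X.addLink (Prod.map σ σ q)) where
  seq := h.seq
  val := h.val
  rel₂ := h.rel₂
  rel₁ := by
    intro p
    have := h.rel₁ p
    rw [List.map_cons, List.mem_cons]
    change p ∈ X.M.R₁ ∨ p ∈ ({_} : Set _) ↔ _
    rw [Set.mem_singleton_iff, this]
    -- The added link cannot have been removed earlier, since removed links lie in the original
    -- `R₁`; hence the order of additions and deletions does not matter.
    have : p = Prod.map σ σ q → p ∉ Em.map (Prod.map σ σ) := by
      rintro rfl hp
      exact h₁ (h.removed _ hp).1
    tauto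
  added := by
    intro p hp
    rcases List.mem_cons.1 (by simpa only [List.map_cons] using hp) with rfl | hp
    · exact ⟨h₂, h₁⟩
    · exact h.added p hp
  removed := h.removed

/-- The successors of the end of the sequence, expressed in the original model. -/
theorem Represents.succ_iff (h : Represents M σ E Ep Em X) (y : Var n) :
    BSat M (oneOf (E.last, y) Ep ⊔ (r₁F E.last y ⊓ ∼(oneOf (E.last, y) Em))) σ ↔
      (X.S.last, σ y) ∈ X.M.R₁ := by
  rw [bsat_sup, bsat_inf, bsat_not, bsat_oneOf, bsat_oneOf, bsat_r₁F, h.rel₁, h.last_eq]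
  -- Added links lie in `R₂` and removed ones do not, so no link is both; this reconciles the two
  -- ways of bracketing the condition.
  have := h.added (Prod.map σ σ (E.last, y))
  have := h.removed (Prod.map σ σ (E.last, y))
  simp only [Prod.map] at *
  tauto

/-- The removable links of the sequence, expressed in the original model. -/
theorem Represents.minusOne_iff (h : Represents M σ E Ep Em X) {y y' : Var n}
    (Φ : ℕ → (L₁ P).BoundedFormula Unit n) {φ : Formula P}
    (hΦ : ∀ i Y, Represents M σ (E.initSeg i) Ep ((y, y') :: Em) Y →
      (BSat M (Φ i) σ ↔ Sat φ Y)) :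
    BSat M (disj ((positions E (Em ++ Ep)).map (fun q =>
        linkEq (y, y') q.1 ⊓ ∼(oneOf (y, y') (E.links.take q.2)) ⊓
          (r₁F y y' ⊓ ∼(r₂F y y') ⊓ Φ q.2)))) σ ↔
      (σ y, σ y') ∈ X.S.links ∧ (σ y, σ y') ∉ X.M.R₂ ∧ Sat φ (X.cutLink (σ y, σ y')) := by
  -- If `i` is the first position of `E` whose link takes the given value, then cutting the sequence
  -- of values at that value is cutting `E` after `i`.
  have hrep : ∀ i, E.links[i]?.map (Prod.map σ σ) = some (σ y, σ y') →
      (σ y, σ y') ∉ (E.links.take i).map (Prod.map σ σ) →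
      (σ y, σ y') ∈ M.R₁ → (σ y, σ y') ∉ M.R₂ →
      Represents M σ (E.initSeg i) Ep ((y, y') :: Em) (X.cutLink (σ y, σ y')) := by
    intro i hi hlt h₁ h₂
    refine h.remove (q := (y, y')) ?_ rfl h₁ h₂
    change X.S.cut _ = _
    rw [NESeq.initSeg_image, ← h.seq]
    apply NESeq.cut_eq_initSeg
    · rw [h.links_eq, List.getElem?_map, hi]
    · rwa [h.links_eq, ← List.map_take]
  simp only [bsat_disj, List.mem_map, exists_exists_and_eq_and, bsat_inf, bsat_not, bsat_linkEq]
  simp only [bsat_oneOf, bsat_r₁F, bsat_r₂F]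
  constructor
  · rintro ⟨⟨p, i⟩, hp, ⟨he, hlt⟩, ⟨h₁, h₂⟩, hs⟩
    obtain ⟨hp, -⟩ := List.mem_filter.1 hp
    have hp : E.links[i]? = some p := List.mk_mem_zipIdx_iff_getElem?.1 hp
    have hi : E.links[i]?.map (Prod.map σ σ) = some (σ y, σ y') := by
      rw [hp, Option.map_some, ← he]; rfl
    refine ⟨?_, h.rel₂ ▸ h₂, (hΦ i _ (hrep i hi hlt h₁ h₂)).1 hs⟩
    rw [h.links_eq]
    exact List.mem_of_getElem? (List.getElem?_map ▸ hi)
  · rintro ⟨hmem, h₂, hs⟩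
    rw [h.rel₂] at h₂
    have hX := (h.rel₁ _).1 (X.chain _ hmem)
    -- A removable link is outside `R₂`, so it was not added and must belong to the original `R₁`.
    have hplus : (σ y, σ y') ∉ Ep.map (Prod.map σ σ) := fun hc => h₂ (h.added _ hc).1
    have h₁ : (σ y, σ y') ∈ M.R₁ := hX.1.resolve_right hplus
    classical
    rw [h.links_eq] at hmem
    -- Distinct links of variables may have the same value, so the first occurrence is sought in the
    -- list of values.
    set l := E.links.map (Prod.map σ σ) with hl
    have hlen : l.idxOf (σ y, σ y') < l.length := List.idxOf_lt_length_of_mem hmem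
    have hget : l[l.idxOf (σ y, σ y')]? = some (σ y, σ y') := by
      rw [List.getElem?_eq_getElem hlen]; simp
    have hlt : (σ y, σ y') ∉ l.take (l.idxOf (σ y, σ y')) := by
      intro hc
      obtain ⟨j, hj, hjp⟩ := List.mem_iff_getElem.1 hc
      have hj' : j < l.idxOf (σ y, σ y') := by
        simp only [List.length_take] at hj
        omega
      have := List.not_of_lt_findIdx (p := (· == (σ y, σ y'))) (xs := l) hj'
      rw [List.getElem_take] at hjp
      simp [hjp] at this
    set i := l.idxOf (σ y, σ y')
    rw [hl, List.getElem?_map] at hget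
    rw [hl, ← List.map_take] at hlt
    obtain ⟨p, hp, hpe⟩ := Option.map_eq_some_iff.1 hget
    refine ⟨(p, i), ?_, ⟨hpe.symm, hlt⟩, ⟨h₁, h₂⟩, (hΦ i _ (hrep i hget hlt h₁ h₂)).2 hs⟩
    refine List.mem_filter.2 ⟨List.mk_mem_zipIdx_iff_getElem?.2 hp, ?_⟩
    -- The filter compares variables. The position found passes it because even the value of its
    -- link is neither removed nor added.
    simp only [decide_eq_true_eq]
    rintro q hq rfl
    have hq' := List.mem_map_of_mem (f := Prod.map σ σ) hq
    rw [List.map_append, List.mem_append, hpe] at hq'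
    exact hq'.elim hX.2 hplus

end

/-- `Represents` is the induction invariant: the claim has to be made for all recorded changes at
once, since each modality hands a longer record to its subformula. -/
theorem bsat_translate_iff {M : Model P W} (φ : Formula P) :
    ∀ {n : ℕ} {σ : Var n → W} {E : NESeq (Var n)} {Ep Em : List (Var n × Var n)}
      {X : Pointed P W}, Represents M σ E Ep Em X →
      (BSat M (translate φ n E Ep Em) σ ↔ Sat φ X) := by
  induction φ with
  | atom p =>
    intro n σ E Ep Em X h
    rw [translate, bsat_predF, Sat, h.val, h.last_eq]
  | neg φ ih =>
    intro n σ E Ep Em X h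
    rw [translate, bsat_not, Sat, ih h]
  | and φ ψ ih₁ ih₂ =>
    intro n σ E Ep Em X h
    rw [translate, bsat_inf, Sat, ih₁ h, ih₂ h]
  | dia φ ih =>
    intro n σ E Ep Em X h
    rw [translate, bsat_ex, Sat]
    refine exists_congr fun a => ?_
    have hu := h.up a
    rw [bsat_inf, hu.succ_iff, extend_fresh, ← exists_prop]
    refine exists_congr fun hv => ih ?_
    have := hu.move (fresh n) (by rwa [extend_fresh])
    simpa only [extend_fresh] using this
  | minusOne φ ih =>
    intro n σ E Ep Em X h
    rw [translate, bsat_ex, Sat, Prod.exists]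
    refine exists_congr fun a => ?_
    rw [bsat_ex]
    refine exists_congr fun b => ?_
    rw [((h.up a).up b).minusOne_iff (φ := φ) (y := up (fresh n)) (y' := fresh (n + 1))
      (fun i => translate φ (n + 2) (((E.map up).map up).initSeg i) (upLinks (upLinks Ep))
        ((up (fresh n), fresh (n + 1)) :: upLinks (upLinks Em)))
      (fun i Y hY => ih hY), extend_fresh, extend_up, extend_fresh]
  | minusTwo φ ih =>
    intro n σ E Ep Em X h
    rw [translate, bsat_ex, Sat, Prod.exists]
    refine exists_congr fun a => ?_
    rw [bsat_ex]
    refine exists_congr fun b => ?_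
    have hu := (h.up a).up b
    have hq : Prod.map (extend (extend σ a) b) (extend (extend σ a) b)
        (up (fresh n), fresh (n + 1)) = (a, b) := by
      simp [extend_up, extend_fresh]
    have key : ∀ hl : (a, b) ∉ X.S.links, (a, b) ∈ M.R₁ → (a, b) ∉ M.R₂ → _ :=
      fun hl h₁ h₂ => ih (hu.remove (q := (up (fresh n), fresh (n + 1)))
        (Y := X.removeLink (a, b) hl) hu.seq (by rw [hq]; rfl) (by rwa [hq]) (by rwa [hq]))
    simp only [bsat_inf, bsat_not, bsat_oneOf, bsat_r₁F, bsat_r₂F, hq, List.map_append,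
      List.mem_append, ← hu.links_eq, extend_up, extend_fresh]
    have h₁ := hu.rel₁ (a, b)
    have hp := hu.added (a, b)
    rw [← hu.rel₂] at *
    constructor
    · rintro ⟨⟨⟨h1, h2⟩, h3⟩, h4⟩
      have hl : (a, b) ∉ X.S.links := by tauto
      exact ⟨hl, by tauto, h3, (key hl h1 h3).1 h4⟩
    · rintro ⟨hl, h1, h3, h4⟩
      -- A present link outside `R₂` is not an added one, so it is original.
      have h1' : (a, b) ∈ M.R₁ := by tauto
      exact ⟨⟨⟨h1', by tauto⟩, h3⟩, (key hl h1' h3).2 h4⟩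
  | plus φ ih =>
    intro n σ E Ep Em X h
    rw [translate, bsat_ex, Sat, Prod.exists]
    refine exists_congr fun a => ?_
    rw [bsat_ex]
    refine exists_congr fun b => ?_
    have hu := (h.up a).up b
    have hq : Prod.map (extend (extend σ a) b) (extend (extend σ a) b)
        (up (fresh n), fresh (n + 1)) = (a, b) := by
      simp [extend_up, extend_fresh]
    have key : (a, b) ∉ M.R₁ → (a, b) ∈ M.R₂ → _ := fun h₁ h₂ =>
      ih (hu.insert (q := (up (fresh n), fresh (n + 1))) (by rwa [hq]) (by rwa [hq]))
    rw [hq] at key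
    simp only [bsat_inf, bsat_not, bsat_oneOf, bsat_r₁F, bsat_r₂F, hq, List.map_append,
      List.mem_append, extend_up, extend_fresh]
    have h₁ := hu.rel₁ (a, b)
    have hm := hu.removed (a, b)
    rw [← hu.rel₂] at *
    constructor
    · rintro ⟨⟨⟨h1, h2⟩, h3⟩, h4⟩
      exact ⟨h3, by tauto, (key h2 h3).1 h4⟩
    · rintro ⟨h3, h2, h4⟩
      -- A link in `R₂` was never removed, so its absence now means that it was absent originally.
      have h2' : (a, b) ∉ M.R₁ := by tauto
      exact ⟨⟨⟨by tauto, h2'⟩, h3⟩, (key h2' h3).2 h4⟩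

theorem foSat_translation_iff (φ : Formula P) (M : Model P W) (w : W) :
    FOSat M (translation φ) w ↔ Sat φ (Pointed.single M w) := by
  have h : Represents (n := 0) M (fun _ => w) (NESeq.single (Sum.inl ())) [] []
      (Pointed.single M w) := by
    refine ⟨rfl, rfl, rfl, fun q => ?_, by simp, by simp⟩
    simp [Pointed.single]
  rw [← bsat_translate_iff φ h]
  let := M.toStructure
  unfold FOSat BSat translation Language.Formula.Realize
  rw [iff_iff_eq]
  congr 1
  exact Subsingleton.elim _ _

end SLL

namespace SLL

open Filter

/-! ## Ultraproducts of pointed models -/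

section Ultraproduct

variable {P : Type} {W : ℕ → Type u} {U : Ultrafilter ℕ}

/-- The element of the ultraproduct given by a family of worlds. -/
def mk (U : Ultrafilter ℕ) (a : ∀ n, W n) : (U : Filter ℕ).Product W :=
  Quotient.mk _ a

/-- The link of the ultraproduct given by a family of links. -/
def mkLink (U : Ultrafilter ℕ) (q : (∀ n, W n) × (∀ n, W n)) :
    (U : Filter ℕ).Product W × (U : Filter ℕ).Product W :=
  Prod.map (mk U) (mk U) q

/-- The value of a family of worlds at `n`. -/
def ev (n : ℕ) (a : ∀ n, W n) : W n := a n

/-- The value of a family of links at `n`. -/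
def evLink (n : ℕ) (q : (∀ n, W n) × (∀ n, W n)) : W n × W n :=
  Prod.map (ev n) (ev n) q

theorem mk_eq_mk_iff {a b : ∀ n, W n} : mk U a = mk U b ↔ ∀ᶠ n in U, ev n a = ev n b :=
  Quotient.eq

theorem mk_surjective (x : (U : Filter ℕ).Product W) : ∃ a, mk U a = x :=
  Quotient.exists_rep x

theorem mkLink_eq_mkLink_iff {q r : (∀ n, W n) × (∀ n, W n)} :
    mkLink U q = mkLink U r ↔ ∀ᶠ n in U, evLink n q = evLink n r := by
  simp [mkLink, evLink, Prod.ext_iff, mk_eq_mk_iff, eventually_and]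

theorem mkLink_surjective (p : (U : Filter ℕ).Product W × (U : Filter ℕ).Product W) :
    ∃ q, mkLink U q = p := by
  obtain ⟨a, ha⟩ := mk_surjective p.1
  obtain ⟨b, hb⟩ := mk_surjective p.2
  exact ⟨(a, b), Prod.ext ha hb⟩

/-- The list is finite and fixed, and an ultrafilter commutes with finite disjunctions. -/
theorem mem_map_mkLink_iff {q : (∀ n, W n) × (∀ n, W n)}
    {l : List ((∀ n, W n) × (∀ n, W n))} :
    mkLink U q ∈ l.map (mkLink U) ↔ ∀ᶠ n in U, evLink n q ∈ l.map (evLink n) := by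
  induction l with
  | nil => simpa using U.neBot.ne
  | cons r l ih =>
    simp only [List.map_cons, List.mem_cons, Ultrafilter.eventually_or, ih, mkLink_eq_mkLink_iff]

open Classical in
-- Each of the finitely many comparisons with `q` is decided in the same way for almost all `n`, so
-- the first hit is too. This makes `S|_p` commute with ultraproducts.
theorem eventually_idxOf_eq (q : (∀ n, W n) × (∀ n, W n))
    (l : List ((∀ n, W n) × (∀ n, W n))) :
    ∀ᶠ n in U, (l.map (evLink n)).idxOf (evLink n q) = (l.map (mkLink U)).idxOf (mkLink U q) := by
  induction l with
  | nil => simp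
  | cons r l ih =>
    by_cases h : mkLink U r = mkLink U q
    · filter_upwards [mkLink_eq_mkLink_iff.1 h] with n hn
      simp [h, hn]
    · have h' := h
      rw [mkLink_eq_mkLink_iff, ← Ultrafilter.eventually_not] at h'
      filter_upwards [h', ih] with n hn hi
      rw [List.map_cons, List.map_cons, List.idxOf_cons_ne _ hn, List.idxOf_cons_ne _ h, hi]

/-- `M` is the ultraproduct of the models `Mn n`. -/
structure IsLimModel (U : Ultrafilter ℕ) (Mn : ∀ n, Model P (W n))
    (M : Model P ((U : Filter ℕ).Product W)) : Prop where
  val : ∀ p a, mk U a ∈ M.V p ↔ ∀ᶠ n in U, ev n a ∈ (Mn n).V p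
  rel₁ : ∀ q, mkLink U q ∈ M.R₁ ↔ ∀ᶠ n in U, evLink n q ∈ (Mn n).R₁
  rel₂ : ∀ q, mkLink U q ∈ M.R₂ ↔ ∀ᶠ n in U, evLink n q ∈ (Mn n).R₂

/-- `S` is the sequence of the ultraproduct given by the sequences `Sn n`, which have the same
length for almost all `n`. -/
def IsLimSeq (U : Ultrafilter ℕ) (Sn : ∀ n, NESeq (W n))
    (S : NESeq ((U : Filter ℕ).Product W)) : Prop :=
  ∃ s : NESeq (∀ n, W n), S = s.image (mk U) ∧ ∀ᶠ n in U, Sn n = s.image (ev n)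

/-- `X` is the ultraproduct of the pointed models `Xn n`. -/
structure IsLim (U : Ultrafilter ℕ) (Xn : ∀ n, Pointed P (W n))
    (X : Pointed P ((U : Filter ℕ).Product W)) : Prop where
  model : IsLimModel U (fun n => (Xn n).M) X.M
  seq : IsLimSeq U (fun n => (Xn n).S) X.S

theorem IsLimModel.congr {Mn Mn' : ∀ n, Model P (W n)} {M : Model P ((U : Filter ℕ).Product W)}
    (h : IsLimModel U Mn M) (he : ∀ᶠ n in U, Mn n = Mn' n) : IsLimModel U Mn' M where
  val p a := (h.val p a).trans (eventually_congr (he.mono fun n hn => by rw [hn]))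
  rel₁ q := (h.rel₁ q).trans (eventually_congr (he.mono fun n hn => by rw [hn]))
  rel₂ q := (h.rel₂ q).trans (eventually_congr (he.mono fun n hn => by rw [hn]))

theorem IsLimSeq.congr {Sn Sn' : ∀ n, NESeq (W n)} {S : NESeq ((U : Filter ℕ).Product W)}
    (h : IsLimSeq U Sn S) (he : ∀ᶠ n in U, Sn n = Sn' n) : IsLimSeq U Sn' S := by
  obtain ⟨s, hs, hn⟩ := h
  exact ⟨s, hs, by filter_upwards [hn, he] with n h₁ h₂; rw [← h₂, h₁]⟩

theorem IsLimModel.remove {Mn : ∀ n, Model P (W n)} {M : Model P ((U : Filter ℕ).Product W)}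
    (h : IsLimModel U Mn M) (q : (∀ n, W n) × (∀ n, W n)) :
    IsLimModel U (fun n => (Mn n).remove (evLink n q)) (M.remove (mkLink U q)) where
  val := h.val
  rel₁ r := by
    simp only [Model.remove, Set.mem_sdiff, Set.mem_singleton_iff, eventually_and,
      Ultrafilter.eventually_not, h.rel₁, mkLink_eq_mkLink_iff]
  rel₂ := h.rel₂

theorem IsLimModel.insert {Mn : ∀ n, Model P (W n)} {M : Model P ((U : Filter ℕ).Product W)}
    (h : IsLimModel U Mn M) (q : (∀ n, W n) × (∀ n, W n)) :
    IsLimModel U (fun n => (Mn n).insert (evLink n q)) (M.insert (mkLink U q)) where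
  val := h.val
  rel₁ r := by
    simp only [Model.insert, Set.mem_union, Set.mem_singleton_iff, Ultrafilter.eventually_or,
      h.rel₁, mkLink_eq_mkLink_iff]
  rel₂ := h.rel₂

theorem IsLimModel.next {Mn : ∀ n, Model P (W n)} {M : Model P ((U : Filter ℕ).Product W)}
    (h : IsLimModel U Mn M) (k : Modality) (q : (∀ n, W n) × (∀ n, W n)) :
    IsLimModel U (fun n => nextModel k (Mn n) (evLink n q)) (nextModel k M (mkLink U q)) := by
  cases k with
  | dia => exact h
  | minusOne => exact h.remove q
  | minusTwo => exact h.remove q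
  | plus => exact h.insert q

theorem IsLimSeq.next {Sn : ∀ n, NESeq (W n)} {S : NESeq ((U : Filter ℕ).Product W)}
    (h : IsLimSeq U Sn S) (k : Modality) (q : (∀ n, W n) × (∀ n, W n)) :
    IsLimSeq U (fun n => nextSeq k (Sn n) (evLink n q)) (nextSeq k S (mkLink U q)) := by
  classical
  cases k with
  | dia =>
    obtain ⟨s, rfl, hn⟩ := h
    refine ⟨s.snoc q.2, (NESeq.snoc_image ..).symm, hn.mono fun n hn => ?_⟩
    rw [NESeq.snoc_image, ← hn]
    rfl
  | minusOne =>
    obtain ⟨s, rfl, hn⟩ := h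
    refine ⟨s.initSeg (((s.image (mk U)).links).idxOf (mkLink U q)), ?_, ?_⟩
    · rw [NESeq.initSeg_image]
      rfl
    · filter_upwards [hn, eventually_idxOf_eq (U := U) q s.links] with n h₁ h₂
      rw [NESeq.initSeg_image, ← h₁]
      change (Sn n).initSeg ((Sn n).links.idxOf (evLink n q)) = _
      congr 1
      rw [h₁, NESeq.links_image, NESeq.links_image]
      exact h₂
  | minusTwo => exact h
  | plus => exact h

theorem IsLimSeq.mem_links_iff {Sn : ∀ n, NESeq (W n)} {S : NESeq ((U : Filter ℕ).Product W)}
    (h : IsLimSeq U Sn S) (q : (∀ n, W n) × (∀ n, W n)) :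
    mkLink U q ∈ S.links ↔ ∀ᶠ n in U, evLink n q ∈ (Sn n).links := by
  obtain ⟨s, rfl, hn⟩ := h
  rw [NESeq.links_image]
  refine mem_map_mkLink_iff.trans (eventually_congr (hn.mono fun n hn => ?_))
  rw [hn, NESeq.links_image]
  rfl

theorem IsLimSeq.mk_eq_last_iff {Sn : ∀ n, NESeq (W n)}
    {S : NESeq ((U : Filter ℕ).Product W)} (h : IsLimSeq U Sn S) (a : ∀ n, W n) :
    mk U a = S.last ↔ ∀ᶠ n in U, ev n a = (Sn n).last := by
  obtain ⟨s, rfl, hn⟩ := h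
  rw [NESeq.last_image, mk_eq_mk_iff]
  refine eventually_congr (hn.mono fun n hn => ?_)
  rw [hn, NESeq.last_image]

variable {Xn : ∀ n, Pointed P (W n)} {X Y : Pointed P ((U : Filter ℕ).Product W)}

/-- Each enabling condition is a Boolean combination of memberships and equalities that transfer,
and an ultrafilter commutes with the Boolean operations. -/
theorem IsLim.enabled_iff (h : IsLim U Xn X) (k : Modality) (q : (∀ n, W n) × (∀ n, W n)) :
    Enabled k X (mkLink U q) ↔ ∀ᶠ n in U, Enabled k (Xn n) (evLink n q) := by
  cases k with
  | dia =>
    simp only [Enabled, eventually_and, h.model.rel₁]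
    exact and_congr_right fun _ => h.seq.mk_eq_last_iff q.1
  | minusOne =>
    simp only [Enabled, eventually_and, Ultrafilter.eventually_not, h.model.rel₂,
      h.seq.mem_links_iff]
  | minusTwo =>
    simp only [Enabled, eventually_and, Ultrafilter.eventually_not, h.model.rel₁, h.model.rel₂,
      h.seq.mem_links_iff]
  | plus =>
    simp only [Enabled, eventually_and, Ultrafilter.eventually_not, h.model.rel₁, h.model.rel₂]

theorem IsLim.linkStep (h : IsLim U Xn X) {k : Modality} {q : (∀ n, W n) × (∀ n, W n)}
    (hY : LinkStep k X (mkLink U q) Y) {Yn : ∀ n, Pointed P (W n)}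
    (hn : ∀ᶠ n in U, LinkStep k (Xn n) (evLink n q) (Yn n)) : IsLim U Yn Y where
  model := by
    rw [hY.model]
    exact (h.model.next k q).congr (hn.mono fun n hn => hn.model.symm)
  seq := by
    rw [hY.seq]
    exact (h.seq.next k q).congr (hn.mono fun n hn => hn.seq.symm)

/-- A step from an ultraproduct is the ultraproduct of steps. -/
theorem IsLim.exists_of_linkStep (h : IsLim U Xn X) {k : Modality} {p}
    (hY : LinkStep k X p Y) :
    ∃ q Yn, (∀ᶠ n in U, LinkStep k (Xn n) (evLink n q) (Yn n)) ∧ IsLim U Yn Y := by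
  classical
  obtain ⟨q, rfl⟩ := mkLink_surjective p
  have hq := (h.enabled_iff k q).1 hY.enabled
  -- The value `Xn n` is a dummy for the negligible set of `n` where the step is not possible.
  let Yn : ∀ n, Pointed P (W n) := fun n =>
    if hn : Enabled k (Xn n) (evLink n q) then hn.exists_linkStep.choose else Xn n
  have hYn : ∀ᶠ n in U, LinkStep k (Xn n) (evLink n q) (Yn n) := by
    filter_upwards [hq] with n hn
    simp only [Yn, dif_pos hn]
    exact hn.exists_linkStep.choose_spec
  exact ⟨q, Yn, hYn, h.linkStep hY hYn⟩

/-- The ultraproduct of steps is a step. -/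
theorem IsLim.exists_of_eventually_linkStep (h : IsLim U Xn X) {k : Modality}
    {pn : ∀ n, W n × W n} {Yn : ∀ n, Pointed P (W n)}
    (hn : ∀ᶠ n in U, LinkStep k (Xn n) (pn n) (Yn n)) :
    ∃ p Y, LinkStep k X p Y ∧ IsLim U Yn Y := by
  let q : (∀ n, W n) × (∀ n, W n) := (fun n => (pn n).1, fun n => (pn n).2)
  have hn : ∀ᶠ n in U, LinkStep k (Xn n) (evLink n q) (Yn n) := hn
  obtain ⟨Y, hY⟩ := ((h.enabled_iff k q).2 (hn.mono fun n hn => hn.enabled)).exists_linkStep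
  exact ⟨_, Y, hY, h.linkStep hY hn⟩

/-- Łoś's theorem for SLL. -/
theorem sat_lim_iff (φ : Formula P) :
    ∀ {Xn : ∀ n, Pointed P (W n)} {X : Pointed P ((U : Filter ℕ).Product W)}, IsLim U Xn X →
      (Sat φ X ↔ ∀ᶠ n in U, Sat φ (Xn n)) := by
  induction φ using Formula.modal_induction with
  | atom p =>
    intro Xn X h
    obtain ⟨a, ha⟩ := mk_surjective X.S.last
    have := (h.seq.mk_eq_last_iff a).1 ha
    rw [Sat, ← ha, h.model.val]
    exact eventually_congr (this.mono fun n hn => by rw [hn, Sat])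
  | neg φ ih =>
    intro Xn X h
    simp only [Sat, ih h, Ultrafilter.eventually_not]
  | and φ ψ ih₁ ih₂ =>
    intro Xn X h
    simp only [Sat, ih₁ h, ih₂ h, eventually_and]
  | app k φ ih =>
    intro Xn X h
    constructor
    · intro hs
      obtain ⟨p, Y, hY, hs⟩ := sat_app_iff.1 hs
      obtain ⟨q, Yn, hYn, hl⟩ := h.exists_of_linkStep hY
      filter_upwards [hYn, (ih hl).1 hs] with n h₁ h₂
      exact sat_app_iff.2 ⟨_, _, h₁, h₂⟩
    · intro hs
      classical
      -- The link and the target are chosen together; the default is used only on a negligible set.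
      let r : ∀ n, (W n × W n) × Pointed P (W n) := fun n =>
        if hn : ∃ r : (W n × W n) × Pointed P (W n), LinkStep k (Xn n) r.1 r.2 ∧ Sat φ r.2 then
          hn.choose else (((Xn n).S.last, (Xn n).S.last), Xn n)
      have hr : ∀ᶠ n in U, LinkStep k (Xn n) (r n).1 (r n).2 ∧ Sat φ (r n).2 := by
        filter_upwards [hs] with n hn
        obtain ⟨p, Y, hp⟩ := sat_app_iff.1 hn
        have hn : ∃ r : (W n × W n) × Pointed P (W n),
          LinkStep k (Xn n) r.1 r.2 ∧ Sat φ r.2 := ⟨(p, Y), hp⟩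
        simp only [r, dif_pos hn]
        exact hn.choose_spec
      obtain ⟨p, Y, hY, hl⟩ := h.exists_of_eventually_linkStep (hr.mono fun n hn => hn.1)
      exact sat_app_iff.2 ⟨p, Y, hY, (ih hl).2 (hr.mono fun n hn => hn.2)⟩

/-- Countable saturation of ultraproducts over `ℕ`. -/
theorem exists_forall_eventually {A : ℕ → Type v} [∀ n, Nonempty (A n)]
    (hU : (U : Filter ℕ) ≤ atTop) (Q : ∀ n, ℕ → A n → Prop)
    (h : ∀ k, ∀ᶠ n in U, ∃ a, ∀ j ≤ k, Q n j a) :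
    ∃ a : ∀ n, A n, ∀ j, ∀ᶠ n in U, Q n j (a n) := by
  classical
  let C : ℕ → ℕ → Prop := fun n k => ∃ a, ∀ j ≤ k, Q n j a
  -- Diagonal choice: at `n`, take a witness for the largest `k ≤ n` such that the conditions up to
  -- `k` are jointly satisfiable. For fixed `j`, almost all `n` satisfy `j ≤ n` and allow `k = j`,
  -- so the chosen `k` is at least `j`.
  refine ⟨fun n => if hn : C n (Nat.findGreatest (C n) n) then hn.choose
    else Classical.arbitrary _, fun j => ?_⟩
  filter_upwards [h j, hU (eventually_ge_atTop j)] with n hn hj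
  have hC : C n (Nat.findGreatest (C n) n) := Nat.findGreatest_spec hj hn
  simp only [dif_pos hC]
  exact hC.choose_spec j (Nat.le_findGreatest hj hn)

end Ultraproduct

/-! ## Modal equivalence -/

section Equivalence

variable {P : Type}

/-- Two pointed models satisfy the same formulas. -/
def ModalEquiv {W W' : Type u} (X : Pointed P W) (X' : Pointed P W') : Prop :=
  ∀ φ, Sat φ X ↔ Sat φ X'

theorem ModalEquiv.symm {W W' : Type u} {X : Pointed P W} {X' : Pointed P W'}
    (h : ModalEquiv X X') : ModalEquiv X' X := fun φ => (h φ).symm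

/-- The conjunction of the formulas `ψ 0, …, ψ k`. -/
def conj (ψ : ℕ → Formula P) : ℕ → Formula P
  | 0 => ψ 0
  | k + 1 => .and (conj ψ k) (ψ (k + 1))

theorem sat_conj_iff {W : Type u} {X : Pointed P W} {ψ : ℕ → Formula P} {k : ℕ} :
    Sat (conj ψ k) X ↔ ∀ j ≤ k, Sat (ψ j) X := by
  induction k with
  | zero => simp [conj]
  | succ k ih =>
    rw [conj, Sat, ih]
    constructor
    · rintro ⟨h₁, h₂⟩ j hj
      rcases Nat.le_succ_iff.1 hj with hj | rfl
      · exact h₁ j hj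
      · exact h₂
    · exact fun h => ⟨fun j hj => h j (hj.trans k.le_succ), h _ le_rfl⟩

/-- A formula determines a natural number. -/
def Formula.code [Encodable P] : Formula P → ℕ
  | .atom p => Nat.pair 0 (Encodable.encode p)
  | .neg φ => Nat.pair 1 φ.code
  | .and φ ψ => Nat.pair 2 (Nat.pair φ.code ψ.code)
  | .dia φ => Nat.pair 3 φ.code
  | .minusOne φ => Nat.pair 4 φ.code
  | .minusTwo φ => Nat.pair 5 φ.code
  | .plus φ => Nat.pair 6 φ.code

theorem Formula.code_injective [Encodable P] : Function.Injective (Formula.code (P := P)) := by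
  intro φ
  induction φ with
  | atom p => intro ψ h; cases ψ <;> simp_all [code, Nat.pair_eq_pair]
  | and φ φ' ih ih' =>
    intro ψ h
    cases ψ <;> simp only [code, Nat.pair_eq_pair] at h <;> try omega
    rw [ih h.2.1, ih' h.2.2]
  | _ φ ih =>
    intro ψ h
    cases ψ <;> simp only [code, Nat.pair_eq_pair] at h <;> try omega
    rw [ih h.2]

/-- The diagonal choice over `ℕ` handles only countably many conditions, so a theory must be
countable to be realized. -/
instance [Countable P] : Countable (Formula P) := by
  have := Encodable.ofCountable P
  exact Formula.code_injective.countable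

instance [Nonempty P] : Nonempty (Formula P) := ⟨.atom (Classical.arbitrary P)⟩

variable {W W' : ℕ → Type u} {U : Ultrafilter ℕ}

/-- Modally equivalent ultraproducts satisfy the forth condition. -/
theorem ModalEquiv.exists_linkStep [Countable P] [Nonempty P] (hU : (U : Filter ℕ) ≤ atTop)
    {V : Type u} {X Y : Pointed P V}
    {Xn' : ∀ n, Pointed P (W' n)} {X' : Pointed P ((U : Filter ℕ).Product W')}
    (hX' : IsLim U Xn' X') (h : ModalEquiv X X') {k : Modality} {p}
    (hY : LinkStep k X p Y) :
    ∃ p' Y', LinkStep k X' p' Y' ∧ (∃ Yn', IsLim U Yn' Y') ∧ ModalEquiv Y Y' := by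
  classical
  obtain ⟨f, hf⟩ := exists_surjective_nat (Formula P)
  -- An enumeration of the complete theory of `Y`; completeness turns its truth in `Y'` into modal
  -- equivalence.
  let ψ : ℕ → Formula P := fun j => if Sat (f j) Y then f j else .neg (f j)
  have hψ : ∀ j, Sat (ψ j) Y := fun j => by
    by_cases hj : Sat (f j) Y <;> simp [ψ, hj, Sat]
  have : ∀ n, Nonempty ((W' n × W' n) × Pointed P (W' n)) := fun n =>
    ⟨(((Xn' n).S.last, (Xn' n).S.last), Xn' n)⟩
  -- Every condition also asks for a step from `Xn' n`, so any one of them ensures that the realized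
  -- pair is a step.
  obtain ⟨r, hr⟩ := exists_forall_eventually (U := U)
    (A := fun n => (W' n × W' n) × Pointed P (W' n)) hU
    (fun n j r => LinkStep k (Xn' n) r.1 r.2 ∧ Sat (ψ j) r.2) (by
      intro m
      -- A finite part of the theory becomes a single formula under the modality, which passes to
      -- `X'` by equivalence and to almost all factors by Łoś.
      have hs : Sat (k.app (conj ψ m)) X :=
        sat_app_iff.2 ⟨p, Y, hY, sat_conj_iff.2 fun j _ => hψ j⟩
      filter_upwards [(sat_lim_iff _ hX').1 ((h _).1 hs)] with n hn
      obtain ⟨p', Y', hY', hs'⟩ := sat_app_iff.1 hn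
      exact ⟨(p', Y'), fun j hj => ⟨hY', sat_conj_iff.1 hs' j hj⟩⟩)
  obtain ⟨p', Y', hY', hl⟩ :=
    hX'.exists_of_eventually_linkStep ((hr 0).mono fun n hn => hn.1)
  refine ⟨p', Y', hY', ⟨_, hl⟩, fun φ => ?_⟩
  obtain ⟨j, rfl⟩ := hf φ
  have hj : Sat (ψ j) Y' := (sat_lim_iff _ hl).2 ((hr j).mono fun n hn => hn.2)
  by_cases hY : Sat (f j) Y
  · simpa [ψ, hY] using hj
  · simpa [ψ, hY, Sat] using hj

/-- Modally equivalent ultraproducts are l-bisimilar. -/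
theorem ModalEquiv.lBisimilar [Countable P] [Nonempty P] (hU : (U : Filter ℕ) ≤ atTop)
    {Xn : ∀ n, Pointed P (W n)} {X : Pointed P ((U : Filter ℕ).Product W)}
    {Xn' : ∀ n, Pointed P (W' n)} {X' : Pointed P ((U : Filter ℕ).Product W')}
    (hX : IsLim U Xn X) (hX' : IsLim U Xn' X') (h : ModalEquiv X X') : LBisimilar X X' := by
  refine lBisimilar_of_linkStep
    -- The factors are quantified existentially because they change with each step.
    (Z := fun X X' => (∃ Xn, IsLim U Xn X) ∧ (∃ Xn', IsLim U Xn' X') ∧ ModalEquiv X X')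
    ⟨⟨_, hX⟩, ⟨_, hX'⟩, h⟩ (fun X X' h p => h.2.2 _) ?_ ?_
  · rintro k X X' ⟨⟨Xn, hX⟩, ⟨Xn', hX'⟩, h⟩ p Y hY
    obtain ⟨p', Y', hY', hl', he⟩ := h.exists_linkStep hU hX' hY
    obtain ⟨-, Yn, -, hl⟩ := hX.exists_of_linkStep hY
    exact ⟨p', Y', hY', ⟨Yn, hl⟩, hl', he⟩
  · rintro k X X' ⟨⟨Xn, hX⟩, ⟨Xn', hX'⟩, h⟩ p' Y' hY'
    obtain ⟨p, Y, hY, hl, he⟩ := h.symm.exists_linkStep hU hX hY'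
    obtain ⟨-, Yn', -, hl'⟩ := hX'.exists_of_linkStep hY'
    exact ⟨p, Y, hY, hl, ⟨Yn', hl'⟩, he.symm⟩

end Equivalence

/-! ## First-order formulas in ultraproducts -/

section Los

variable {P : Type} {W : ℕ → Type u} {U : Ultrafilter ℕ}

/-- The ultraproduct of models. -/
def limModel (U : Ultrafilter ℕ) (Mn : ∀ n, Model P (W n)) :
    Model P ((U : Filter ℕ).Product W) where
  R₁ := {p | ∃ q, mkLink U q = p ∧ ∀ᶠ n in U, evLink n q ∈ (Mn n).R₁}
  R₂ := {p | ∃ q, mkLink U q = p ∧ ∀ᶠ n in U, evLink n q ∈ (Mn n).R₂}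
  V p := {x | ∃ a, mk U a = x ∧ ∀ᶠ n in U, ev n a ∈ (Mn n).V p}

theorem isLimModel_limModel (Mn : ∀ n, Model P (W n)) : IsLimModel U Mn (limModel U Mn) where
  val p a := by
    refine ⟨?_, fun h => ⟨a, rfl, h⟩⟩
    rintro ⟨b, hb, h⟩
    filter_upwards [mk_eq_mk_iff.1 hb, h] with n h₁ h₂
    rwa [← h₁]
  rel₁ q := by
    refine ⟨?_, fun h => ⟨q, rfl, h⟩⟩
    rintro ⟨r, hr, h⟩
    filter_upwards [mkLink_eq_mkLink_iff.1 hr, h] with n h₁ h₂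
    rwa [← h₁]
  rel₂ q := by
    refine ⟨?_, fun h => ⟨q, rfl, h⟩⟩
    rintro ⟨r, hr, h⟩
    filter_upwards [mkLink_eq_mkLink_iff.1 hr, h] with n h₁ h₂
    rwa [← h₁]

theorem isLim_single (Mn : ∀ n, Model P (W n)) (w : ∀ n, W n) :
    IsLim U (fun n => Pointed.single (Mn n) (w n))
      (Pointed.single (limModel U Mn) (mk U w)) where
  model := isLimModel_limModel Mn
  seq := ⟨NESeq.single w, rfl, Eventually.of_forall fun _ => rfl⟩

/-- Identifies the concrete ultraproduct of models with the general one, for which the first-order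
Łoś theorem is stated. -/
theorem toStructure_limModel (Mn : ∀ n, Model P (W n)) :
    (limModel U Mn).toStructure =
      @Language.Ultraproduct.structure ℕ W U (L₁ P) (fun n => (Mn n).toStructure) := by
  let inst := fun n => (Mn n).toStructure
  refine Language.Structure.ext ?_ ?_
  · funext n f
    exact f.elim
  · funext n r x
    choose a ha using fun i => mk_surjective (x i)
    obtain rfl : (fun i => mk U (a i)) = x := funext ha
    refine propext (Iff.trans ?_ (Language.relMap_quotient_mk' (s := productSetoid U W) r a).symm)
    cases r with
    | pred p => exact (isLimModel_limModel Mn).val p (a 0)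
    | r₁ => exact (isLimModel_limModel Mn).rel₁ (a 0, a 1)
    | r₂ => exact (isLimModel_limModel Mn).rel₂ (a 0, a 1)

theorem foSat_limModel_iff (Mn : ∀ n, Model P (W n)) (w : ∀ n, W n)
    (α : (L₁ P).Formula Unit) :
    FOSat (limModel U Mn) α (mk U w) ↔ ∀ᶠ n in U, FOSat (Mn n) α (w n) := by
  unfold FOSat
  rw [toStructure_limModel]
  let inst := fun n => (Mn n).toStructure
  have : ∀ n, Nonempty (W n) := fun n => ⟨w n⟩
  exact Language.Ultraproduct.realize_formula_cast (u := U) α fun _ => w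

end Los

/-! ## The characterization theorem -/

section Characterization

variable {P : Type}

/-- A property of pointed models that depends only on the truth of finitely many formulas is
defined by a formula, relative to any class `K` of pointed models. -/
theorem exists_formula_of_finite [Nonempty P] (A : ∀ {W : Type u}, Pointed P W → Prop)
    (L : List (Formula P)) : ∀ (K : ∀ {W : Type u}, Pointed P W → Prop),
    (∀ {W W' : Type u} (X : Pointed P W) (X' : Pointed P W'), K X → K X' →
      (∀ φ ∈ L, Sat φ X ↔ Sat φ X') → A X → A X') →
    ∃ φ : Formula P, ∀ {W : Type u} (X : Pointed P W), K X → (A X ↔ Sat φ X) := by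
  induction L with
  | nil =>
    intro K h
    have p := Classical.arbitrary P
    let bot : Formula P := .and (.atom p) (.neg (.atom p))
    have hbot : ∀ {W : Type u} (X : Pointed P W), ¬ Sat bot X := fun X hX => hX.2 hX.1
    -- With no formulas left to consult, `A` is constant on `K`.
    by_cases hA : ∃ (W : Type u) (X : Pointed P W), K X ∧ A X
    · obtain ⟨W, X, hK, hX⟩ := hA
      exact ⟨.neg bot, fun X' hK' => iff_of_true (h X X' hK hK' (by simp) hX) (hbot X')⟩
    · refine ⟨bot, fun X hK => iff_of_false (fun hX => hA ⟨_, X, hK, hX⟩) (hbot X)⟩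
  | cons ψ L ih =>
    intro K h
    -- Splitting `K` by the truth of `ψ` makes agreement on `ψ` automatic in each half; this is why
    -- `K` varies in the induction.
    obtain ⟨φ₁, h₁⟩ := ih (fun X => K X ∧ Sat ψ X) fun X X' hX hX' hL =>
      h X X' hX.1 hX'.1 (List.forall_mem_cons.2 ⟨iff_of_true hX.2 hX'.2, hL⟩)
    obtain ⟨φ₂, h₂⟩ := ih (fun X => K X ∧ ¬ Sat ψ X) fun X X' hX hX' hL =>
      h X X' hX.1 hX'.1 (List.forall_mem_cons.2 ⟨iff_of_false hX.2 hX'.2, hL⟩)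
    -- This is `(ψ ∧ φ₁) ∨ (¬ψ ∧ φ₂)`, written without disjunction.
    refine ⟨.neg (.and (.neg (.and ψ φ₁)) (.neg (.and (.neg ψ) φ₂))), fun X hK => ?_⟩
    simp only [Sat]
    by_cases hψ : Sat ψ X
    · rw [h₁ X ⟨hK, hψ⟩]
      tauto
    · rw [h₂ X ⟨hK, hψ⟩]
      tauto

/-- If no formula is equivalent to `α`, finitely many formulas do not determine the truth value
of `α`. -/
theorem exists_agree_of_not_equiv [Nonempty P] {α : (L₁ P).Formula Unit}
    (h : ¬ ∃ φ : Formula P, FOEquiv.{u} α (translation φ)) (L : List (Formula P)) :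
    ∃ (W W' : Type u) (M : Model P W) (w : W) (M' : Model P W') (w' : W'),
      (∀ φ ∈ L, Sat φ (Pointed.single M w) ↔ Sat φ (Pointed.single M' w')) ∧
        FOSat M α w ∧ ¬ FOSat M' α w' := by
  by_contra hc
  push Not at hc
  refine h ?_
  obtain ⟨φ, hφ⟩ := exists_formula_of_finite.{u} (fun X => FOSat X.M α X.S.last) L
    -- `K` consists of the pointed models with a one-term sequence, the only ones that `α` speaks
    -- about.
    (fun X => X = Pointed.single X.M X.S.last) (by
      intro W W' X X' hX hX' hL hA
      rw [hX, hX'] at hL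
      exact hc W W' X.M X.S.last X'.M X'.S.last hL hA)
  refine ⟨φ, fun W M w => ?_⟩
  rw [foSat_translation_iff]
  exact hφ (Pointed.single M w) rfl

end Characterization

end SLL

open Filter in
theorem mainTheorem1 {P : Type} [Countable P] [Nonempty P]
    (α : (SLL.L₁ P).Formula Unit) :
    (∃ φ : SLL.Formula P, SLL.FOEquiv.{u} α (SLL.translation φ)) ↔
      SLL.LBisimInvariant.{u} α := by
  constructor
  · rintro ⟨φ, hφ⟩ W W' M M' w w' ⟨Z, hZ, h⟩
    rw [hφ, hφ, SLL.foSat_translation_iff, SLL.foSat_translation_iff]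
    exact hZ.sat_iff φ _ _ h
  · intro hα
    by_contra hne
    obtain ⟨f, hf⟩ := exists_surjective_nat (SLL.Formula P)
    choose W W' M w M' w' hL hs hs' using fun n =>
      SLL.exists_agree_of_not_equiv hne ((List.range n).map f)
    let U : Ultrafilter ℕ := hyperfilter ℕ
    have hU : (U : Filter ℕ) ≤ atTop := Nat.hyperfilter_le_atTop
    have hX := SLL.isLim_single (U := U) M w
    have hX' := SLL.isLim_single (U := U) M' w'
    have he : SLL.ModalEquiv (SLL.Pointed.single (SLL.limModel U M) (SLL.mk U w))
        (SLL.Pointed.single (SLL.limModel U M') (SLL.mk U w')) := by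
      intro φ
      obtain ⟨j, rfl⟩ := hf φ
      rw [SLL.sat_lim_iff _ hX, SLL.sat_lim_iff _ hX']
      refine eventually_congr ?_
      -- The formula `f j` is among those on which the `n`-th pair agrees as soon as `n > j`, hence
      -- for almost all `n`.
      filter_upwards [hU (eventually_gt_atTop j)] with n hn
      exact hL n _ (List.mem_map_of_mem (List.mem_range.2 hn))
    have hb := hα _ _ _ _ _ _ (he.lBisimilar hU hX hX')
    rw [SLL.foSat_limModel_iff, SLL.foSat_limModel_iff] at hb
    exact (hb.1 (Eventually.of_forall hs)).exists.elim fun n hn => hs' n hn
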